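/- A hypergraph $\mathcal H$ contains a hypergraph $\mathcal G$ as a trace if there is a set $S\subseteq V(\mathcal H)$ with $|S|=|V(\mathcal G)|$ such that the hypergraph $\{e\cap S : e\in E(\mathcal H)\}$ on $S$ contains a copy of $\mathcal G$ as a subgraph. Let $\mathrm{ex}_r(n,\mathrm{Tr}_r(\mathcal G))$ be the maximum number of hyperedges of an $r$-uniform hypergraph on $n$ vertices that does not contain $\mathcal G$ as a trace, and let $M_{s+1}$ be the matching with $s+1$ edges (on $2s+2$ vertices). For every integer $s\ge 1$ there is an $N$ such that for all $n\ge N$: $$\mathrm{ex}_3(n,\mathrm{Tr}_3(M_{s+1}))=\left\lfloor\frac{s(s+2)}{2}\right\rfloor (n-s-2)+\binom{s+2}{3}.$$ Moreover, a $3$-uniform hypergraph $\mathcal H$ on $n$ vertices that does not contain $M_{s+1}$ as a trace attains this maximum only if it is constructed as follows, and every hypergraph so constructed does not contain $M_{s+1}$ as a trace and attains the maximum. Let $G$ be a graph obtained from the complete graph $K_{s+2}$, on a set of $s+2$ of the $n$ vertices, by removing the edges of a minimum edge cover (a set of edges meeting every vertex, with as few edges as possible). For each of the remaining $n-(s+2)$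 vertices $v$ and each edge $e\in E(G)$, let $\{v\}\cup e$ be a hyperedge; then add every triple contained in $V(G)$ as a hyperedge. Any two hypergraphs constructed in this way are isomorphic, so the extremal hypergraph is unique up to isomorphism. -/

import Mathlib

namespace TraceMatching

/-! A hypergraph with vertex set `V` is given by its finite set of hyperedges, a
`Finset (Finset V)`; it is `r`-uniform when its edge set is `Set.Sized r`. -/

/-- The trace of the hypergraph `H` on the vertex set `S`: the hyperedges `e ∩ S`, `e ∈ H`. -/
def trace {V : Type*} [DecidableEq V] (H : Finset (Finset V)) (S : Finset V) :
    Finset (Finset V) :=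
  H.image (fun e => e ∩ S)

/-- `H` contains `G` as a trace: there is a set `S` of `v(G)` vertices of `H` such that the trace
of `H` on `S` contains (a copy of) `G` as a subgraph. -/
def ContainsAsTrace {V W : Type*} [DecidableEq V] [Fintype W]
    (H : Finset (Finset V)) (G : Finset (Finset W)) : Prop :=
  ∃ S : Finset V, S.card = Fintype.card W ∧
    ∃ φ : W ↪ V, (∀ w, φ w ∈ S) ∧ ∀ g ∈ G, g.map φ ∈ trace H S

/-- `H` is an `r`-uniform hypergraph that does not contain `G` as a trace. -/
def IsTraceFree {V W : Type*} [DecidableEq V] [Fintype W]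
    (r : ℕ) (H : Finset (Finset V)) (G : Finset (Finset W)) : Prop :=
  (H : Set (Finset V)).Sized r ∧ ¬ ContainsAsTrace H G

/-- `ex_r(n, Tr_r(G))`: the maximum number of hyperedges of an `r`-uniform hypergraph on `n`
vertices that does not contain `G` as a trace. (The set is bounded, by `2 ^ n`, and it is nonempty
as soon as `G` has an edge.) -/
noncomputable def exTrace {W : Type*} [Fintype W] (r n : ℕ) (G : Finset (Finset W)) : ℕ :=
  sSup {m | ∃ H : Finset (Finset (Fin n)), IsTraceFree r H G ∧ H.card = m}

/-- The matching `M_m`: the graph on `2 m` vertices `(i, false)`, `(i, true)` with the `m` pairwise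
disjoint edges `{(i, false), (i, true)}`. -/
def matching (m : ℕ) : Finset (Finset (Fin m × Bool)) :=
  Finset.univ.image (fun i => {(i, false), (i, true)})

/-- `C` is an edge cover of `G`: a set of edges of `G` meeting every vertex. -/
def IsEdgeCover {W : Type*} (G : SimpleGraph W) (C : Finset (Sym2 W)) : Prop :=
  (∀ e ∈ C, e ∈ G.edgeSet) ∧ ∀ v : W, ∃ e ∈ C, v ∈ e

/-- `C` is a minimum edge cover of `G`: an edge cover with the least number of edges. -/
def IsMinimumEdgeCover {W : Type*} (G : SimpleGraph W) (C : Finset (Sym2 W)) : Prop :=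
  IsEdgeCover G C ∧ ∀ C' : Finset (Sym2 W), IsEdgeCover G C' → C.card ≤ C'.card

open Classical in
/-- Place the graph `G` inside the vertex set `V` by means of `φ`. The hyperedges are
`{v, φ a, φ b}` for all `v` outside (the copy of) `V(G)` and all edges `ab` of `G`, and all triples
contained in `V(G)`. -/
noncomputable def cone {V W : Type*} [Fintype V] (G : SimpleGraph W) (φ : W ↪ V) :
    Finset (Finset V) :=
  Finset.univ.filter (fun e =>
    (∃ v, v ∉ Set.range φ ∧ ∃ a b, G.Adj a b ∧ e = {v, φ a, φ b}) ∨
    (e.card = 3 ∧ ∀ x ∈ e, x ∈ Set.range φ))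

/-- `H` arises by the construction: remove a minimum edge cover `C` from `K_{s+2}`, place the
resulting graph in the vertex set and form its `cone`. -/
def IsExtremalConstruction {V : Type*} [Fintype V] (s : ℕ) (H : Finset (Finset V)) : Prop :=
  ∃ C : Finset (Sym2 (Fin (s + 2))),
    IsMinimumEdgeCover (⊤ : SimpleGraph (Fin (s + 2))) C ∧
    ∃ φ : Fin (s + 2) ↪ V,
      H = cone ((⊤ : SimpleGraph (Fin (s + 2))).deleteEdges (C : Set (Sym2 (Fin (s + 2))))) φ

/-- Two hypergraphs are isomorphic. -/
def Isomorphic {V V' : Type*} (H : Finset (Finset V)) (H' : Finset (Finset V')) : Prop :=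
  ∃ σ : V ≃ V', ∀ e : Finset V, e.map σ.toEmbedding ∈ H' ↔ e ∈ H

end TraceMatching

/-!
In a 3-uniform hypergraph, `M_{s+1}` is a trace exactly if there are hyperedges `{a_i, b_i, c_i}`,
`0 ≤ i ≤ s`, whose pairs `{a_i, b_i}` are disjoint and contain no `c_j`.

Call a pair of vertices heavy if it lies in at least `3 (s + 1)` hyperedges. If some `s + 1`
vertices `x` each have a heavy neighbour `y x` outside the set they form (the set is *escaping*), then
hyperedges `{x, y x, z x}` with new vertices `z x` give the pairs `{x, z x}` and so the trace
(`containsAsTrace_of_escaping`). Hence in the graph of heavy pairs every escaping set has at most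
`s` vertices. The complement of an escaping set is dominating, and Vizing's bound on the number of edges
of a graph with given domination number applies: there are at most `s (s + 2) / 2` heavy pairs
(`sum_degree_le`), and if that many, rounded down, are attained, then they form `K_{s+2}` without a
minimum edge cover (`exists_support_of_card_edgeFinset`).

The hyperedges without a heavy pair are boundedly many, as otherwise they contain `s + 1` disjoint
hyperedges or a vertex whose link contains `s + 1` disjoint pairs (`card_light_le`). So, for large
`n`, a hypergraph with fewer than `s (s + 2) / 2` (rounded down) heavy pairs is too small. If there
are that many, then a hyperedge outside the cone over the heavy graph would provide one pair, and
heavy pairs the remaining `s`; this places the hypergraph inside the cone (`subset_cone`), which is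
trace-free itself (`not_containsAsTrace_cone`).

Minimum edge covers of `K_{s+2}` consist of disjoint edges and at most one path with two edges. An
involution encodes the disjoint edges, and involutions with equally many fixed points are conjugate;
this makes all the constructions isomorphic (`exists_perm_adj_iff`).
-/

namespace TraceMatching

open Finset

/-! ### Matchings as traces -/

/-- A matching as a trace, unpacked: hyperedges `{a i, b i, c i}` whose pairs `{a i, b i}` are
disjoint and whose third vertices `c i` avoid all the pairs. The `c i` need not be distinct. -/
theorem containsAsTrace_matching_of {V ι : Type*} [DecidableEq V] [Fintype ι]
    {H : Finset (Finset V)} (a b c : ι → V) (hH : ∀ i, {a i, b i, c i} ∈ H)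
    (hab : Function.Injective (Sum.elim a b)) (hca : ∀ i j, c i ≠ a j) (hcb : ∀ i j, c i ≠ b j) :
    ContainsAsTrace H (matching (Fintype.card ι)) := by
  let ε := (Fintype.equivFin ι).symm
  have hinj : Function.Injective
      (fun w : Fin (Fintype.card ι) × Bool => if w.2 then b (ε w.1) else a (ε w.1)) := by
    rintro ⟨i, x⟩ ⟨j, y⟩ h
    cases x <;> cases y <;> simp only [Bool.false_eq_true, if_true, if_false] at h
    · have := @hab (.inl (ε i)) (.inl (ε j)) h
      simpa using this
    · have := @hab (.inl (ε i)) (.inr (ε j)) h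
      simp at this
    · have := @hab (.inr (ε i)) (.inl (ε j)) h
      simp at this
    · have := @hab (.inr (ε i)) (.inr (ε j)) h
      simpa using this
  refine ⟨Finset.univ.map ⟨_, hinj⟩, by simp, ⟨_, hinj⟩, fun w => by simp, ?_⟩
  intro g hg
  obtain ⟨i, -, rfl⟩ := Finset.mem_image.1 hg
  refine Finset.mem_image.2 ⟨_, hH (ε i), ?_⟩
  ext x
  simp only [Finset.mem_inter, Finset.mem_insert, Finset.mem_singleton, Finset.mem_map,
    Finset.mem_univ, true_and, Function.Embedding.coeFn_mk, Prod.exists, Bool.exists_bool,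
    Finset.map_insert, Finset.map_singleton]
  simp only [Bool.false_eq_true, if_true, if_false]
  constructor
  · rintro ⟨rfl | rfl | rfl, h⟩
    · exact Or.inl rfl
    · exact Or.inr rfl
    · obtain ⟨j, hj | hj⟩ := h
      · exact absurd hj.symm (hca _ _)
      · exact absurd hj.symm (hcb _ _)
  · rintro (rfl | rfl)
    · exact ⟨Or.inl rfl, i, Or.inl rfl⟩
    · exact ⟨Or.inr (Or.inl rfl), i, Or.inr rfl⟩

/-- The converse of `containsAsTrace_matching_of` for 3-uniform hypergraphs. -/
theorem exists_of_containsAsTrace_matching {V : Type*} [DecidableEq V] {H : Finset (Finset V)}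
    (hH : (H : Set (Finset V)).Sized 3) {m : ℕ} (h : ContainsAsTrace H (matching m)) :
    ∃ a b c : Fin m → V, (∀ i, {a i, b i, c i} ∈ H) ∧ Function.Injective (Sum.elim a b) ∧
      (∀ i j, c i ≠ a j) ∧ ∀ i j, c i ≠ b j := by
  obtain ⟨S, hS, φ, hφ, h⟩ := h
  have hrange : ∀ x ∈ S, x ∈ Finset.univ.map φ := by
    have hsub : Finset.univ.map φ ⊆ S := fun x hx => by
      obtain ⟨w, -, rfl⟩ := Finset.mem_map.1 hx
      exact hφ w
    rw [Finset.eq_of_subset_of_card_le hsub (by rw [hS, Finset.card_map, Finset.card_univ])]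
    exact fun x hx => hx
  have key : ∀ i : Fin m, ∃ c, {φ (i, false), φ (i, true), c} ∈ H ∧ c ∉ S := by
    intro i
    obtain ⟨e, he, heS⟩ := Finset.mem_image.1 (h {(i, false), (i, true)}
      (Finset.mem_image_of_mem _ (Finset.mem_univ i)))
    have hcard : (e ∩ S).card = 2 := by
      rw [heS, Finset.card_map, Finset.card_pair (by simp)]
    have h1 : (e \ S).card = 1 := by
      have := Finset.card_sdiff_add_card_inter e S
      have h3 : e.card = 3 := hH he
      omega
    obtain ⟨c, hc⟩ := Finset.card_eq_one.1 h1
    refine ⟨c, ?_, ?_⟩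
    · convert he
      rw [← Finset.sdiff_union_inter e S, hc, heS]
      ext x
      simp only [Finset.map_insert, Finset.map_singleton, Finset.mem_insert, Finset.mem_singleton,
        Finset.mem_union]
      tauto
    · have : c ∈ e \ S := by simp [hc]
      exact (Finset.mem_sdiff.1 this).2
  choose c hc hcS using key
  refine ⟨fun i => φ (i, false), fun i => φ (i, true), c, hc, ?_, ?_, ?_⟩
  · rintro (i | i) (j | j) hij
    · simpa using hij
    · simp at hij
    · simp at hij
    · simpa using hij
  · exact fun i j hij => hcS i (hij ▸ hφ _)
  · exact fun i j hij => hcS i (hij ▸ hφ _)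

/-! ### Vizing's bound and its extremal graphs -/

section Vizing

variable {V : Type*} [Fintype V] [DecidableEq V]

/-- A set of vertices is escaping if each of its vertices has a neighbour outside the set, that is,
if its complement is a dominating set. -/
def Escaping {V : Type*} (G : SimpleGraph V) (X : Finset V) : Prop :=
  ∀ x ∈ X, ∃ y, y ∉ X ∧ G.Adj x y

theorem Escaping.mono {V : Type*} {G : SimpleGraph V} {X Y : Finset V} (h : Escaping G X)
    (hYX : Y ⊆ X) : Escaping G Y := fun x hx => by
  obtain ⟨y, hy, hxy⟩ := h x (hYX hx)
  exact ⟨y, fun hyY => hy (hYX hyY), hxy⟩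

/-- The graph `G[S]`, kept on the whole vertex type: the vertices outside `S` become isolated. -/
def restrict {V : Type*} (G : SimpleGraph V) (S : Finset V) : SimpleGraph V where
  Adj x y := G.Adj x y ∧ x ∈ S ∧ y ∈ S
  symm := ⟨fun _ _ h => ⟨h.1.symm, h.2.2, h.2.1⟩⟩
  loopless := ⟨fun _ h => h.1.ne rfl⟩

@[simp]
theorem restrict_adj {V : Type*} {G : SimpleGraph V} {S : Finset V} {x y : V} :
    (restrict G S).Adj x y ↔ G.Adj x y ∧ x ∈ S ∧ y ∈ S := Iff.rfl

instance (G : SimpleGraph V) [DecidableRel G.Adj] (S : Finset V) :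
    DecidableRel (restrict G S).Adj :=
  fun x y => inferInstanceAs (Decidable (G.Adj x y ∧ x ∈ S ∧ y ∈ S))

/-- The vertices outside the closed neighbourhood of `v`. -/
def far (G : SimpleGraph V) [DecidableRel G.Adj] (v : V) : Finset V :=
  (insert v (G.neighborFinset v))ᶜ

variable {G : SimpleGraph V} [DecidableRel G.Adj] {s : ℕ}

theorem mem_far {v x : V} : x ∈ far G v ↔ x ≠ v ∧ ¬ G.Adj v x := by
  simp [far]

theorem sum_degree_restrict (S : Finset V) :
    ∑ x, (restrict G S).degree x = ∑ x ∈ S, #(G.neighborFinset x ∩ S) := by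
  rw [← Finset.sum_subset (Finset.subset_univ S)]
  · refine Finset.sum_congr rfl fun x hx => ?_
    rw [← SimpleGraph.card_neighborFinset_eq_degree]
    congr 1
    ext y
    simp [hx]
  · intro x _ hx
    rw [← SimpleGraph.card_neighborFinset_eq_degree, Finset.card_eq_zero]
    ext y
    simp [hx]

/-- The degree sum, split along the closed neighbourhood of `v`; the edges between the neighbourhood
and `far G v` are counted from the side of the neighbourhood. -/
theorem sum_degree_eq (v : V) :
    ∑ x, G.degree x = ∑ u ∈ G.neighborFinset v, (G.degree u + #(G.neighborFinset u ∩ far G v))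
      + G.degree v + ∑ x, (restrict G (far G v)).degree x := by
  have h1 : ∑ x, G.degree x
      = ∑ x ∈ insert v (G.neighborFinset v), G.degree x + ∑ x ∈ far G v, G.degree x :=
    (Finset.sum_add_sum_compl _ _).symm
  have h2 : ∀ x ∈ far G v, G.degree x
      = #(G.neighborFinset v ∩ G.neighborFinset x) + #(G.neighborFinset x ∩ far G v) := by
    intro x hx
    rw [mem_far] at hx
    rw [← SimpleGraph.card_neighborFinset_eq_degree, ← Finset.card_union_of_disjoint]
    · congr 1
      ext y
      simp only [mem_union, mem_inter, SimpleGraph.mem_neighborFinset, mem_far]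
      constructor
      · intro h
        by_cases hy : G.Adj v y
        · exact Or.inl ⟨hy, h⟩
        · refine Or.inr ⟨h, ?_, hy⟩
          rintro rfl
          exact hx.2 h.symm
      · tauto
    · rw [Finset.disjoint_left]
      intro y hy hy'
      simp only [mem_inter, SimpleGraph.mem_neighborFinset, mem_far] at hy hy'
      exact hy'.2.2 hy.1
  have h3 : ∑ x ∈ far G v, #(G.neighborFinset v ∩ G.neighborFinset x)
      = ∑ u ∈ G.neighborFinset v, #(G.neighborFinset u ∩ far G v) := by
    have := Finset.sum_card_bipartiteAbove_eq_sum_card_bipartiteBelow (s := far G v)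
      (t := G.neighborFinset v) G.Adj
    convert this using 3 with x hx x hx
    · ext y
      simp [Finset.bipartiteAbove]
    · ext y
      simp only [mem_inter, SimpleGraph.mem_neighborFinset, bipartiteBelow, mem_filter]
      rw [G.adj_comm, and_comm]
  rw [h1, Finset.sum_insert (by simp), Finset.sum_congr rfl h2, Finset.sum_add_distrib, h3,
    sum_degree_restrict, Finset.sum_add_distrib]
  ring

omit [DecidableEq V] in
theorem degree_le_of_escaping (hG : ∀ X, Escaping G X → #X ≤ s) (v : V) : G.degree v ≤ s := by
  rw [← SimpleGraph.card_neighborFinset_eq_degree]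
  refine hG _ fun x hx => ⟨v, by simp, ?_⟩
  simpa [G.adj_comm] using hx

/-- The set `(N(v) \ {u}) ∪ (N(u) ∩ far G v)` is escaping, through `v` and `u`. -/
theorem card_neighborFinset_inter_far_le (hG : ∀ X, Escaping G X → #X ≤ s) {u v : V}
    (huv : G.Adj v u) : #(G.neighborFinset u ∩ far G v) + G.degree v ≤ s + 1 := by
  have h := hG ((G.neighborFinset v).erase u ∪ (G.neighborFinset u ∩ far G v)) (by
    intro x hx
    simp only [mem_union, mem_erase, mem_inter, SimpleGraph.mem_neighborFinset, mem_far] at hx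
    rcases hx with hx | hx
    · exact ⟨v, by simp [mem_far], hx.2.symm⟩
    · exact ⟨u, by simp [mem_far], hx.1.symm⟩)
  rw [Finset.card_union_of_disjoint, Finset.card_erase_of_mem (by simpa using huv),
    SimpleGraph.card_neighborFinset_eq_degree] at h
  · omega
  · rw [Finset.disjoint_left]
    intro y hy hy'
    simp only [mem_erase, mem_inter, SimpleGraph.mem_neighborFinset, mem_far] at hy hy'
    exact hy'.2.2 hy.2

/-- An escaping set of `G[far G v]` stays escaping in `G` when `N(v)` is added to it. -/
theorem card_le_of_escaping_restrict_far (hG : ∀ X, Escaping G X → #X ≤ s) (v : V) (X : Finset V)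
    (hX : Escaping (restrict G (far G v)) X) : #X ≤ s - G.degree v := by
  have hXf : ∀ x ∈ X, x ∈ far G v := fun x hx => by
    obtain ⟨y, -, hy⟩ := hX x hx
    exact hy.2.1
  have h := hG (G.neighborFinset v ∪ X) (by
    intro x hx
    rcases mem_union.1 hx with hx | hx
    · refine ⟨v, ?_, by simpa [G.adj_comm] using hx⟩
      simp only [mem_union, SimpleGraph.mem_neighborFinset, SimpleGraph.irrefl, false_or]
      exact fun h => (mem_far.1 (hXf v h)).1 rfl
    · obtain ⟨y, hyX, hy⟩ := hX x hx
      refine ⟨y, ?_, hy.1⟩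
      simp only [mem_union, SimpleGraph.mem_neighborFinset, not_or]
      exact ⟨(mem_far.1 hy.2.2).2, hyX⟩)
  rw [Finset.card_union_of_disjoint, SimpleGraph.card_neighborFinset_eq_degree] at h
  · omega
  · rw [Finset.disjoint_left]
    intro y hy hy'
    exact (mem_far.1 (hXf y hy')).2 (by simpa using hy)

omit [DecidableEq V] in
theorem exists_forall_degree_le [Nonempty V] (G : SimpleGraph V) [DecidableRel G.Adj] :
    ∃ v, ∀ u, G.degree u ≤ G.degree v := by
  obtain ⟨v, -, hv⟩ := Finset.exists_max_image Finset.univ (fun v => G.degree v)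
    Finset.univ_nonempty
  exact ⟨v, fun u => hv u (Finset.mem_univ u)⟩

theorem sum_neighborFinset_le (hG : ∀ X, Escaping G X → #X ≤ s) {v : V}
    (hv : ∀ u, G.degree u ≤ G.degree v) :
    ∑ u ∈ G.neighborFinset v, (G.degree u + #(G.neighborFinset u ∩ far G v))
      ≤ G.degree v * (s + 1) := by
  rw [← SimpleGraph.card_neighborFinset_eq_degree, ← smul_eq_mul]
  refine Finset.sum_le_card_nsmul _ _ _ fun u hu => ?_
  have h1 := card_neighborFinset_inter_far_le hG (u := u) (v := v) (by simpa using hu)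
  have h2 := hv u
  omega

/-- Vizing's bound on the number of edges in terms of the domination number, in the form: if every
escaping set has at most `s` vertices, then there are at most `s (s + 2) / 2` edges. By induction on
`s`, splitting off the closed neighbourhood of a vertex of maximum degree. -/
theorem sum_degree_le (hG : ∀ X, Escaping G X → #X ≤ s) : ∑ v, G.degree v ≤ s * (s + 2) := by
  induction s using Nat.strong_induction_on generalizing G with
  | _ s ih =>
    rcases isEmpty_or_nonempty V with hV | hV
    · simp
    obtain ⟨v, hv⟩ := exists_forall_degree_le G
    rcases Nat.eq_zero_or_pos (G.degree v) with h0 | hpos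
    · rw [Finset.sum_eq_zero fun u _ => Nat.le_zero.1 (h0 ▸ hv u)]
      exact Nat.zero_le _
    have hs := degree_le_of_escaping hG v
    have h2 := ih (s - G.degree v) (by omega) (card_le_of_escaping_restrict_far hG v)
    have h1 := sum_neighborFinset_le hG hv
    rw [sum_degree_eq v]
    obtain ⟨r, rfl⟩ := Nat.exists_eq_add_of_le hs
    rw [Nat.add_sub_cancel_left] at h2
    -- With `d` the maximum degree and `r = s - d`, the sum is at most `s (s + 2) - d r`.
    nlinarith

/-- If Vizing's bound is attained, then a vertex of maximum degree has degree `s`, the vertices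
outside its closed neighbourhood are independent, and the sum over its neighbourhood in
`sum_degree_eq` is within one of its largest possible value. -/
theorem degree_eq_of_le_card_edgeFinset (hs : 1 ≤ s) (hG : ∀ X, Escaping G X → #X ≤ s)
    (he : s * (s + 2) / 2 ≤ #G.edgeFinset) {v : V} (hv : ∀ u, G.degree u ≤ G.degree v) :
    G.degree v = s ∧ (∀ x y, G.Adj x y → x ∈ far G v → y ∉ far G v) ∧
      s * (s + 1) ≤ ∑ u ∈ G.neighborFinset v,
        (G.degree u + #(G.neighborFinset u ∩ far G v)) + 1 := by
  have hsum := G.sum_degrees_eq_twice_card_edges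
  have heq := sum_degree_eq (G := G) v
  have h1 := sum_neighborFinset_le hG hv
  have hle := degree_le_of_escaping hG v
  have h2 := sum_degree_le (card_le_of_escaping_restrict_far hG v)
  have hpos : 1 ≤ G.degree v := by
    by_contra h0
    rw [Finset.sum_eq_zero fun u _ => Nat.le_zero.1 ((hv u).trans (by omega))] at hsum
    have : 3 ≤ s * (s + 2) := by nlinarith
    omega
  have hdeg : G.degree v = s := by
    obtain ⟨r, hr⟩ := Nat.exists_eq_add_of_le hle
    generalize G.degree v = d at *
    subst hr
    rw [Nat.add_sub_cancel_left] at h2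
    -- The loss `d r` in the induction is at most the rounding in `s (s + 2) / 2`, and `d = r = 1`
    -- means `s = 2`, where nothing is rounded.
    have hdr : d * r ≤ 1 := by
      have : (d + r) * (d + r + 2) ≤ 2 * #G.edgeFinset + 1 := by omega
      nlinarith
    rcases Nat.eq_zero_or_pos r with rfl | hr
    · rfl
    have hd1 : d = 1 := by nlinarith
    have hr1 : r = 1 := by nlinarith
    subst hd1 hr1
    omega
  refine ⟨hdeg, ?_, ?_⟩
  · rw [hdeg, Nat.sub_self, Nat.zero_mul, Nat.le_zero] at h2
    intro x y hxy hx hy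
    have := (Finset.sum_eq_zero_iff.1 h2) x (Finset.mem_univ x)
    rw [← SimpleGraph.card_neighborFinset_eq_degree, Finset.card_eq_zero] at this
    have hy' : y ∈ (restrict G (far G v)).neighborFinset x := by
      simp only [SimpleGraph.mem_neighborFinset]
      exact ⟨hxy, hx, hy⟩
    rw [this] at hy'
    simp at hy'
  · rw [hdeg, Nat.sub_self, Nat.zero_mul] at h2
    have : s * (s + 2) ≤ 2 * #G.edgeFinset + 1 := by omega
    nlinarith

/-- In a graph attaining the bound, at most one vertex outside the closed neighbourhood of a vertex
of maximum degree is not isolated. -/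
theorem eq_of_adj_far (hs : 1 ≤ s) (hG : ∀ X, Escaping G X → #X ≤ s)
    (he : s * (s + 2) / 2 ≤ #G.edgeFinset) {v : V} (hv : ∀ u, G.degree u ≤ G.degree v)
    {w₁ w₂ x₁ x₂ : V} (hw₁ : w₁ ∈ far G v) (hw₂ : w₂ ∈ far G v) (h₁ : G.Adj x₁ w₁)
    (h₂ : G.Adj x₂ w₂) : w₁ = w₂ := by
  by_contra hne
  obtain ⟨hdeg, hfar, hsum⟩ := degree_eq_of_le_card_edgeFinset hs hG he hv
  have hcN : #(G.neighborFinset v) = s := by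
    rw [SimpleGraph.card_neighborFinset_eq_degree, hdeg]
  have hmemN : ∀ {x w}, w ∈ far G v → G.Adj x w → G.Adj v x := by
    intro x w hw h
    by_contra hx
    by_cases hxv : x = v
    · exact (mem_far.1 hw).2 (hxv ▸ h)
    · exact hfar x w h (mem_far.2 ⟨hxv, hx⟩) hw
  -- Each vertex of the neighbourhood contributes at most `s + 1` to the sum in `hsum`, which is
  -- within one of the maximum; so at most one neighbour falls short, and only by one.
  have hfs : ∀ u, G.Adj v u → #(G.neighborFinset u ∩ far G v) ≤ 1 := fun u hu => by
    have := card_neighborFinset_inter_far_le hG hu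
    omega
  have hds : ∀ u, G.degree u ≤ s := fun u => hdeg ▸ hv u
  have hone : ∀ u, G.Adj v u → s ≤ G.degree u + #(G.neighborFinset u ∩ far G v) := by
    intro u hu
    have h1 := Finset.sum_le_card_nsmul ((G.neighborFinset v).erase u)
      (fun u => G.degree u + #(G.neighborFinset u ∩ far G v)) (s + 1) (fun x hx => by
        have h1 := hfs x (by simpa using (mem_erase.1 hx).2)
        have h2 := hds x
        omega)
    rw [Finset.card_erase_of_mem (by simpa using hu), hcN, smul_eq_mul] at h1
    rw [← Finset.add_sum_erase _ _ ((G.mem_neighborFinset v u).2 hu)] at hsum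
    obtain ⟨t, rfl⟩ := Nat.exists_eq_add_of_le' hs
    rw [Nat.add_sub_cancel] at h1
    nlinarith
  have htwo : ∀ u u', G.Adj v u → G.Adj v u' → u ≠ u' →
      2 * s + 1 ≤ G.degree u + #(G.neighborFinset u ∩ far G v) +
        (G.degree u' + #(G.neighborFinset u' ∩ far G v)) := by
    intro u u' hu hu' huu
    have hu'' : u' ∈ (G.neighborFinset v).erase u := by simpa [huu.symm] using hu'
    have h1 := Finset.sum_le_card_nsmul (((G.neighborFinset v).erase u).erase u')
      (fun u => G.degree u + #(G.neighborFinset u ∩ far G v)) (s + 1) (fun x hx => by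
        have h1 := hfs x (by simpa using (mem_erase.1 (mem_erase.1 hx).2).2)
        have h2 := hds x
        omega)
    rw [Finset.card_erase_of_mem hu'', Finset.card_erase_of_mem (by simpa using hu), hcN,
      smul_eq_mul] at h1
    rw [← Finset.add_sum_erase _ _ ((G.mem_neighborFinset v u).2 hu),
      ← Finset.add_sum_erase _ _ hu''] at hsum
    have hs2 : 2 ≤ s := by
      rw [← hcN, ← Finset.card_pair huu]
      refine Finset.card_le_card ?_
      intro x hx
      simp only [mem_insert, mem_singleton] at hx
      rcases hx with rfl | rfl <;> simpa
    obtain ⟨t, rfl⟩ := Nat.exists_eq_add_of_le' hs2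
    rw [show t + 2 - 1 - 1 = t by omega] at h1
    nlinarith
  have hdegree : ∀ u, G.Adj v u → G.degree u
      = 1 + #(G.neighborFinset u ∩ G.neighborFinset v) + #(G.neighborFinset u ∩ far G v) := by
    intro u hu
    have h : G.neighborFinset u = insert v (G.neighborFinset u ∩ G.neighborFinset v) ∪
        (G.neighborFinset u ∩ far G v) := by
      ext y
      simp only [mem_union, mem_insert, mem_inter, SimpleGraph.mem_neighborFinset, mem_far]
      constructor
      · intro h
        tauto
      · rintro ((rfl | h) | h)
        · exact hu.symm
        · exact h.1
        · exact h.1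
    rw [← SimpleGraph.card_neighborFinset_eq_degree]
    conv_lhs => rw [h]
    rw [Finset.card_union_of_disjoint, Finset.card_insert_of_notMem (by simp)]
    · omega
    · rw [Finset.disjoint_left]
      intro y hy hy'
      simp only [mem_insert, mem_inter, SimpleGraph.mem_neighborFinset, mem_far] at hy hy'
      tauto
  have huniq : ∀ {u w w'}, G.Adj v u → w ∈ far G v → w' ∈ far G v → G.Adj u w → G.Adj u w' →
      w = w' := fun {u w w'} hu hw hw' h h' =>
    Finset.card_le_one.1 (hfs u hu) w (by simp [h, hw]) w' (by simp [h', hw'])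
  let W := {w ∈ far G v | ∃ x, G.Adj x w}
  have hw₁W : w₁ ∈ W := by simp only [W, mem_filter]; exact ⟨hw₁, x₁, h₁⟩
  have hw₂W : w₂ ∈ W := by simp only [W, mem_filter]; exact ⟨hw₂, x₂, h₂⟩
  -- No choice of one neighbour for each vertex of `W` dominates the neighbourhood of `v`:
  -- everything else would be an escaping set with more than `s` vertices.
  have hrep : ∀ ρ : V → V, (∀ w ∈ W, G.Adj (ρ w) w) →
      ∃ y, G.Adj v y ∧ ∀ w ∈ W, ρ w ≠ y ∧ ¬ G.Adj y (ρ w) := by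
    intro ρ hρ
    by_contra! hdom
    have hsub : W.image ρ ⊆ insert v (G.neighborFinset v) ∪ W := by
      intro t ht
      obtain ⟨w, hw, rfl⟩ := mem_image.1 ht
      have := hmemN (mem_filter.1 hw).1 (hρ w hw)
      simp [this]
    have hnt : ∀ w ∈ W, G.Adj v (ρ w) := fun w hw => hmemN (mem_filter.1 hw).1 (hρ w hw)
    have h := hG ((insert v (G.neighborFinset v) ∪ W) \ W.image ρ) (by
      intro x hx
      rw [mem_sdiff, mem_union, mem_insert, SimpleGraph.mem_neighborFinset] at hx
      obtain ⟨(rfl | hx) | hx, hxT⟩ := hx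
      · exact ⟨ρ w₁, by simp [mem_image_of_mem ρ hw₁W], hnt w₁ hw₁W⟩
      · obtain ⟨w, hw, h⟩ := hdom x hx
        refine ⟨ρ w, by simp [mem_image_of_mem ρ hw], h ?_⟩
        rintro rfl
        exact hxT (mem_image_of_mem ρ hw)
      · exact ⟨ρ x, by simp [mem_image_of_mem ρ hx], (hρ x hx).symm⟩)
    have hcard : #(insert v (G.neighborFinset v) ∪ W) = s + 1 + #W := by
      rw [Finset.card_union_of_disjoint, Finset.card_insert_of_notMem (by simp), hcN]
      rw [Finset.disjoint_left]
      intro y hy hy'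
      have := mem_far.1 (mem_filter.1 hy').1
      simp only [mem_insert, SimpleGraph.mem_neighborFinset] at hy
      tauto
    rw [Finset.card_sdiff_of_subset hsub, hcard] at h
    have := Finset.card_image_le (s := W) (f := ρ)
    omega
  have hex : ∀ w, ∃ u, w ∈ W → G.Adj u w := fun w => by
    by_cases hw : w ∈ W
    · obtain ⟨u, hu⟩ := (mem_filter.1 hw).2
      exact ⟨u, fun _ => hu⟩
    · exact ⟨v, fun h => absurd h hw⟩
  choose ρ hρ using hex
  have hρN : ∀ w ∈ W, G.Adj v (ρ w) := fun w hw => hmemN (mem_filter.1 hw).1 (hρ w hw)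
  have hρne : ∀ w ∈ W, ∀ w' ∈ W, w ≠ w' → ρ w ≠ ρ w' := fun w hw w' hw' hww h =>
    hww (huniq (hρN w hw) (mem_filter.1 hw).1 (mem_filter.1 hw').1 (hρ w hw) (h ▸ hρ w' hw'))
  obtain ⟨y, hvy, hy⟩ := hrep ρ hρ
  -- The missed vertex `y` has at least two non-neighbours in `N(v)`, so it is the one that falls
  -- short, and every other vertex has exactly one non-neighbour.
  have hy2 : #(G.neighborFinset y ∩ G.neighborFinset v) + 3 ≤ s := by
    have hsub : G.neighborFinset y ∩ G.neighborFinset v ⊆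
        (((G.neighborFinset v).erase y).erase (ρ w₁)).erase (ρ w₂) := by
      intro z hz
      simp only [mem_inter, SimpleGraph.mem_neighborFinset, mem_erase] at hz ⊢
      refine ⟨?_, ?_, ?_, hz.2⟩
      · rintro rfl
        exact (hy w₂ hw₂W).2 hz.1
      · rintro rfl
        exact (hy w₁ hw₁W).2 hz.1
      · rintro rfl
        exact hz.1.ne rfl
    have hm1 : ρ w₁ ∈ (G.neighborFinset v).erase y := by
      simp [(hy w₁ hw₁W).1, hρN w₁ hw₁W]
    have hm2 : ρ w₂ ∈ ((G.neighborFinset v).erase y).erase (ρ w₁) := by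
      simp [(hy w₂ hw₂W).1, hρN w₂ hw₂W, hρne w₂ hw₂W w₁ hw₁W (Ne.symm hne)]
    have := Finset.card_le_card hsub
    have h1 := Finset.card_erase_add_one hm2
    have h2 := Finset.card_erase_add_one hm1
    have h3 := Finset.card_erase_add_one ((G.mem_neighborFinset v y).2 hvy)
    omega
  have hy1 := hdegree y hvy
  have hy3 := hone y hvy
  have hy4 := hfs y hvy
  obtain ⟨w₀, hw₀⟩ := Finset.card_pos.1 (show 0 < #(G.neighborFinset y ∩ far G v) by omega)
  rw [mem_inter, SimpleGraph.mem_neighborFinset] at hw₀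
  have hw₀W : w₀ ∈ W := mem_filter.2 ⟨hw₀.2, y, hw₀.1⟩
  -- After `y` replaces the representative of its neighbour `w₀`, the new system does dominate.
  obtain ⟨w, hw, hww₀⟩ : ∃ w ∈ W, w ≠ w₀ := by
    by_cases h : w₁ = w₀
    · exact ⟨w₂, hw₂W, fun h' => hne (h.trans h'.symm)⟩
    · exact ⟨w₁, hw₁W, h⟩
  obtain ⟨z, hvz, hz⟩ := hrep (Function.update ρ w₀ y) (by
    intro w' hw'
    by_cases h : w' = w₀
    · subst h
      simpa using hw₀.1
    · rw [Function.update_of_ne h]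
      exact hρ w' hw')
  have hzw := hz w hw
  have hzy := hz w₀ hw₀W
  rw [Function.update_of_ne hww₀] at hzw
  rw [Function.update_self] at hzy
  have ht1 := hdegree _ (hρN w hw)
  have ht2 := htwo y _ hvy (hρN w hw) (hy w hw).1.symm
  have ht3 := hfs _ (hρN w hw)
  have hsub : G.neighborFinset (ρ w) ∩ G.neighborFinset v ⊆
      (((G.neighborFinset v).erase (ρ w)).erase y).erase z := by
    intro x hx
    simp only [mem_inter, SimpleGraph.mem_neighborFinset, mem_erase] at hx ⊢
    refine ⟨?_, ?_, ?_, hx.2⟩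
    · rintro rfl
      exact hzw.2 hx.1.symm
    · rintro rfl
      exact (hy w hw).2 hx.1.symm
    · rintro rfl
      exact hx.1.ne rfl
  have hm1 : y ∈ (G.neighborFinset v).erase (ρ w) := by
    simp [(hy w hw).1.symm, hvy]
  have hm2 : z ∈ ((G.neighborFinset v).erase (ρ w)).erase y := by
    simp [hvz, hzw.1.symm, hzy.1.symm]
  have := Finset.card_le_card hsub
  have h1 := Finset.card_erase_add_one hm2
  have h2 := Finset.card_erase_add_one hm1
  have h3 := Finset.card_erase_add_one ((G.mem_neighborFinset v _).2 (hρN w hw))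
  have := hds (ρ w)
  omega

/-- If Vizing's bound is attained, then all the edges lie on `s + 2` vertices, on which the
complementary graph has no isolated vertex. -/
theorem exists_support_of_card_edgeFinset (hs : 1 ≤ s) (hV : s + 2 ≤ Fintype.card V)
    (hG : ∀ X, Escaping G X → #X ≤ s) (he : s * (s + 2) / 2 ≤ #G.edgeFinset) :
    ∃ A : Finset V, #A = s + 2 ∧ (∀ x y, G.Adj x y → x ∈ A) ∧
      ∀ a ∈ A, ∃ b ∈ A, b ≠ a ∧ ¬ G.Adj a b := by
  have : Nonempty V := Fintype.card_pos_iff.1 (by omega)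
  obtain ⟨v, hv⟩ := exists_forall_degree_le G
  obtain ⟨hdeg, hfar, -⟩ := degree_eq_of_le_card_edgeFinset hs hG he hv
  have hcN : #(insert v (G.neighborFinset v)) = s + 1 := by
    rw [Finset.card_insert_of_notMem (by simp), SimpleGraph.card_neighborFinset_eq_degree, hdeg]
  obtain ⟨w, hw, hw'⟩ : ∃ w ∈ far G v, ∀ x y, G.Adj x y → x ∈ far G v → x = w := by
    by_cases h : ∃ w ∈ far G v, ∃ x, G.Adj x w
    · obtain ⟨w, hw, x, hx⟩ := h
      exact ⟨w, hw, fun x' y' h' hx' => eq_of_adj_far hs hG he hv hx' hw h'.symm hx⟩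
    · push Not at h
      have hc := Finset.card_compl (insert v (G.neighborFinset v))
      obtain ⟨w, hw⟩ := Finset.card_pos.1 (show 0 < #(far G v) by
        rw [far]
        omega)
      exact ⟨w, hw, fun x y hxy hx => absurd hxy.symm (h x hx y)⟩
  have hcA : #(insert w (insert v (G.neighborFinset v))) = s + 2 := by
    rw [Finset.card_insert_of_notMem (by simpa [far] using hw), hcN]
  refine ⟨insert w (insert v (G.neighborFinset v)), hcA, ?_, ?_⟩
  · intro x y hxy
    rw [mem_insert]
    by_cases hx : x ∈ far G v
    · exact Or.inl (hw' x y hxy hx)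
    · exact Or.inr (by simpa [far, or_iff_not_imp_left] using hx)
  · intro a ha
    by_contra! hall
    have := Finset.card_le_card (s := (insert w (insert v (G.neighborFinset v))).erase a)
      (t := G.neighborFinset a) (fun b hb => by
        rw [SimpleGraph.mem_neighborFinset]
        exact hall b (mem_erase.1 hb).2 (mem_erase.1 hb).1)
    rw [Finset.card_erase_of_mem ha, hcA, SimpleGraph.card_neighborFinset_eq_degree] at this
    have := hv a
    omega

end Vizing

/-! ### Minimum edge covers of complete graphs -/

section NearMatching

variable {W : Type*} [Fintype W] [DecidableEq W]

/-- If all degrees are positive and their sum exceeds the number of vertices by at most one, then at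
most one vertex has degree greater than one. -/
theorem eq_of_two_le_degree {R : SimpleGraph W} [DecidableRel R.Adj]
    (h1 : ∀ v, 1 ≤ R.degree v) (h2 : ∑ v, R.degree v ≤ Fintype.card W + 1) {a b : W}
    (ha : 2 ≤ R.degree a) (hb : 2 ≤ R.degree b) : a = b := by
  by_contra hab
  have hb' : b ∈ univ.erase a := by simp [Ne.symm hab]
  have h3 := Finset.card_nsmul_le_sum ((univ.erase a).erase b) (fun v => R.degree v) 1
    (fun v _ => h1 v)
  rw [← Finset.add_sum_erase _ _ (mem_univ a), ← Finset.add_sum_erase _ _ hb'] at h2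
  have h4 := Finset.card_erase_add_one hb'
  have h5 := Finset.card_erase_add_one (mem_univ a)
  rw [Finset.card_univ] at h5
  rw [smul_eq_mul, mul_one] at h3
  omega

/-- A normal form for a graph whose components are single edges and at most one path with two edges.
The involution `f` exchanges the ends of the isolated edges and fixes the three vertices of the
path, whose centre is `p`; without a path, `f` has no fixed points and `p` is arbitrary. -/
theorem exists_involution {R : SimpleGraph W} [DecidableRel R.Adj] [Nonempty W]
    (h1 : ∀ v, 1 ≤ R.degree v) (h2 : ∑ v, R.degree v ≤ Fintype.card W + 1) :
    ∃ (f : Equiv.Perm W) (p : W), f ^ 2 = 1 ∧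
      (∀ x y, R.Adj x y ↔ x ≠ y ∧ (y = f x ∨ (f x = x ∧ f y = y ∧ (x = p ∨ y = p)))) ∧
      #{x | f x = x} = 3 * (Fintype.card W % 2) ∧ (f p = p ∨ ∀ x, f x ≠ x) := by
  -- `Q x y`: the edge `xy` is a component.
  let Q : W → W → Prop := fun x y =>
    R.Adj x y ∧ (∀ z, R.Adj x z → z = y) ∧ ∀ z, R.Adj y z → z = x
  have hQs : ∀ x y, Q x y → Q y x := fun x y h => ⟨h.1.symm, h.2.2, h.2.1⟩
  have hex : ∀ x, ∃ y, Q x y ∨ (y = x ∧ ∀ z, ¬ Q x z) := fun x => by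
    by_cases h : ∃ y, Q x y
    · exact ⟨h.choose, Or.inl h.choose_spec⟩
    · exact ⟨x, Or.inr ⟨rfl, not_exists.1 h⟩⟩
  choose f hf using hex
  have hfQ : ∀ x y, Q x y → f x = y := fun x y h => by
    rcases hf x with h' | h'
    · exact h.2.1 _ h'.1
    · exact absurd h (h'.2 y)
  have hfix : ∀ x, f x = x ↔ ∀ y, ¬ Q x y := fun x => by
    constructor
    · intro h y hy
      rw [hfQ x y hy] at h
      exact hy.1.ne h.symm
    · intro h
      exact (hf x).elim (fun h' => absurd h' (h _)) (fun h' => h'.1)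
  have hinv : Function.Involutive f := fun x => by
    rcases hf x with h | h
    · exact hfQ _ _ (hQs _ _ h)
    · rw [h.1, h.1]
  have hQf : ∀ x, f x ≠ x → R.Adj x (f x) := fun x hx =>
    (hf x).elim (fun h => h.1) (fun h => absurd h.1 hx)
  have hsum := R.sum_degrees_eq_twice_card_edges
  have huniq : ∀ {x y z}, R.degree x ≤ 1 → R.Adj x y → R.Adj x z → z = y :=
    fun {x y z} hx hy hz => Finset.card_le_one.1
      ((R.card_neighborFinset_eq_degree x).trans_le hx) z (by simpa) y (by simpa)
  refine ⟨hinv.toPerm f, ?_⟩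
  have hcoe : ∀ x, hinv.toPerm f x = f x := fun _ => rfl
  have hsq : hinv.toPerm f ^ 2 = 1 := by
    ext x
    simp [sq, hinv x]
  simp only [hcoe]
  by_cases hp : ∃ p, 2 ≤ R.degree p
  · obtain ⟨p, hp⟩ := hp
    have hone : ∀ x, x ≠ p → R.degree x ≤ 1 := fun x hx => by
      by_contra h
      exact hx (eq_of_two_le_degree h1 h2 (by omega) hp)
    have hfixp : ∀ x, f x = x ↔ x = p ∨ R.Adj p x := by
      intro x
      rw [hfix]
      constructor
      · intro h
        by_contra! hx
        obtain ⟨y, hy⟩ := (R.degree_pos_iff_exists_adj x).1 (h1 x)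
        have hyp : y ≠ p := by
          rintro rfl
          exact hx.2 hy.symm
        exact h y ⟨hy, fun z hz => huniq (hone x hx.1) hy hz,
          fun z hz => huniq (hone y hyp) hy.symm hz⟩
      · have hnu : ∀ y, ¬ ∀ z, R.Adj p z → z = y := by
          intro y h
          have : R.degree p ≤ 1 := by
            rw [← R.card_neighborFinset_eq_degree, Finset.card_le_one]
            intro a ha b hb
            rw [h a (by simpa using ha), h b (by simpa using hb)]
          omega
        rintro (rfl | hx) y hy
        · exact hnu y hy.2.1
        · obtain rfl := hy.2.1 p hx.symm
          exact hnu x hy.2.2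
    have hfp : f p = p := (hfixp p).2 (Or.inl rfl)
    refine ⟨p, hsq, ?_, ?_, Or.inl hfp⟩
    · intro x y
      constructor
      · intro h
        refine ⟨h.ne, ?_⟩
        by_cases hx : x = p
        · subst hx
          exact Or.inr ⟨hfp, (hfixp y).2 (Or.inr h), Or.inl rfl⟩
        by_cases hy : y = p
        · subst hy
          exact Or.inr ⟨(hfixp x).2 (Or.inr h.symm), hfp, Or.inr rfl⟩
        exact Or.inl (hfQ x y ⟨h, fun z hz => huniq (hone x hx) h hz,
          fun z hz => huniq (hone y hy) h.symm hz⟩).symm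
      · rintro ⟨hne, rfl | ⟨hx, hy, rfl | rfl⟩⟩
        · exact hQf x hne.symm
        · exact ((hfixp y).1 hy).resolve_left hne.symm
        · exact (((hfixp x).1 hx).resolve_left hne).symm
    · have hdeg : R.degree p + (Fintype.card W - 1) ≤ ∑ v, R.degree v := by
        have h3 := Finset.card_nsmul_le_sum (univ.erase p) (fun v => R.degree v) 1
          (fun v _ => h1 v)
        rw [smul_eq_mul, mul_one, Finset.card_erase_of_mem (mem_univ p), Finset.card_univ] at h3
        rw [← Finset.add_sum_erase _ _ (mem_univ p)]
        omega
      have hW : 0 < Fintype.card W := Fintype.card_pos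
      have hset : ({x | f x = x} : Finset W) = insert p (R.neighborFinset p) := by
        ext x
        simp [hfixp]
      rw [hset, Finset.card_insert_of_notMem (by simp), R.card_neighborFinset_eq_degree]
      omega
  · push Not at hp
    have hone : ∀ x, R.degree x = 1 := fun x => by
      have := h1 x
      have := hp x
      omega
    have hQ : ∀ x y, R.Adj x y → Q x y := fun x y h =>
      ⟨h, fun z hz => huniq (hone x).le h hz, fun z hz => huniq (hone y).le h.symm hz⟩
    have hno : ∀ x, f x ≠ x := fun x hx => by
      obtain ⟨y, hy⟩ := (R.degree_pos_iff_exists_adj x).1 (h1 x)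
      exact (hfix x).1 hx y (hQ x y hy)
    refine ⟨Classical.arbitrary W, hsq, ?_, ?_, Or.inr hno⟩
    · intro x y
      constructor
      · intro h
        exact ⟨h.ne, Or.inl (hfQ x y (hQ x y h)).symm⟩
      · rintro ⟨hne, rfl | ⟨hx, -⟩⟩
        · exact hQf x (hno x)
        · exact absurd hx (hno x)
    · rw [Finset.sum_congr rfl fun x _ => hone x, Finset.sum_const, Finset.card_univ, smul_eq_mul,
        mul_one] at hsum
      rw [Finset.filter_false_of_mem fun x _ => hno x, Finset.card_empty]
      omega

/-- Involutions with equally many fixed points have the same cycle type. -/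
theorem isConj_of_sq_eq_one {f g : Equiv.Perm W} (hf : f ^ 2 = 1) (hg : g ^ 2 = 1)
    (h : #{x | f x = x} = #{x | g x = x}) : IsConj f g := by
  have hsupp : ∀ f : Equiv.Perm W, #{x | f x = x} + #f.support = Fintype.card W := fun f => by
    rw [← Finset.card_univ]
    exact Finset.card_filter_add_card_filter_not _
  have htype : ∀ f : Equiv.Perm W, f ^ 2 = 1 →
      f.cycleType = Multiset.replicate (Multiset.card f.cycleType) 2 := fun f hf =>
    Multiset.eq_replicate_card.2 ((Equiv.Perm.pow_prime_eq_one_iff (p := 2)).1 hf)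
  have hcard : ∀ f : Equiv.Perm W, f ^ 2 = 1 → Multiset.card f.cycleType * 2 = #f.support := by
    intro f hf
    rw [← Equiv.Perm.sum_cycleType, htype f hf, Multiset.sum_replicate, Multiset.card_replicate,
      smul_eq_mul]
  rw [Equiv.Perm.isConj_iff_cycleType_eq, htype f hf, htype g hg]
  have h1 := hsupp f
  have h2 := hsupp g
  have h3 := hcard f hf
  have h4 := hcard g hg
  congr 1
  omega

/-- Two such graphs on the same vertices are isomorphic. -/
theorem exists_perm_adj_iff {R R' : SimpleGraph W} [DecidableRel R.Adj] [DecidableRel R'.Adj]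
    [Nonempty W] (h1 : ∀ v, 1 ≤ R.degree v) (h2 : ∑ v, R.degree v ≤ Fintype.card W + 1)
    (h1' : ∀ v, 1 ≤ R'.degree v) (h2' : ∑ v, R'.degree v ≤ Fintype.card W + 1) :
    ∃ σ : Equiv.Perm W, ∀ x y, R'.Adj (σ x) (σ y) ↔ R.Adj x y := by
  obtain ⟨f, p, hf, hR, hc, hp⟩ := exists_involution h1 h2
  obtain ⟨g, q, hg, hR', hc', hq⟩ := exists_involution h1' h2'
  obtain ⟨τ, hτ⟩ := isConj_iff.1 (isConj_of_sq_eq_one hf hg (hc.trans hc'.symm))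
  have hτ' : ∀ x, g (τ x) = τ (f x) := fun x => by
    rw [← hτ]
    simp
  have hfg : ∀ x, g (τ x) = τ x ↔ f x = x := fun x => by
    rw [hτ', τ.injective.eq_iff]
  -- A conjugating permutation that moreover matches the two centres: `τ p` and `q` are both fixed
  -- by `g`, so the transposition that exchanges them commutes with `g`.
  obtain ⟨σ, hσ, hσp⟩ : ∃ σ : Equiv.Perm W, (∀ x, g (σ x) = σ (f x)) ∧
      (σ p = q ∨ ∀ x, f x ≠ x) := by
    by_cases hno : ∀ x, f x ≠ x
    · exact ⟨τ, hτ', Or.inr hno⟩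
    have hfp : f p = p := hp.resolve_right hno
    have hgq : g q = q := by
      refine hq.resolve_right fun h => hno fun x hx => ?_
      exact h (τ x) ((hfg x).2 hx)
    have hgp : g (τ p) = τ p := (hfg p).2 hfp
    refine ⟨Equiv.swap (τ p) q * τ, fun x => ?_, Or.inl (by simp)⟩
    simp only [Equiv.Perm.mul_apply]
    rw [← hτ' x]
    generalize τ x = z
    rw [Equiv.swap_apply_def, Equiv.swap_apply_def]
    have e1 : g z = τ p ↔ z = τ p := by
      conv_lhs => rw [← hgp, g.injective.eq_iff]
    have e2 : g z = q ↔ z = q := by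
      conv_lhs => rw [← hgq, g.injective.eq_iff]
    simp only [e1, e2]
    split_ifs <;> simp [*]
  refine ⟨σ, fun x y => ?_⟩
  rw [hR, hR', σ.injective.ne_iff]
  simp only [hσ, σ.injective.eq_iff]
  rcases hσp with rfl | hno
  · simp only [σ.injective.eq_iff]
  · simp [hno]

end NearMatching

section EdgeCover

variable {W : Type*}

theorem IsEdgeCover.exists_adj {C : Finset (Sym2 W)}
    (hC : IsEdgeCover (⊤ : SimpleGraph W) C) (v : W) : ∃ u, u ≠ v ∧ s(v, u) ∈ C := by
  obtain ⟨e, he, hv⟩ := hC.2 v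
  obtain ⟨u, rfl⟩ := Sym2.mem_iff_exists.1 hv
  have := hC.1 _ he
  rw [SimpleGraph.mem_edgeSet, SimpleGraph.top_adj] at this
  exact ⟨u, this.symm, he⟩

theorem one_le_degree_of_isEdgeCover [Fintype W] {C : Finset (Sym2 W)}
    [DecidableRel (SimpleGraph.fromEdgeSet (C : Set (Sym2 W))).Adj]
    (hC : IsEdgeCover (⊤ : SimpleGraph W) C) (v : W) :
    1 ≤ (SimpleGraph.fromEdgeSet (C : Set (Sym2 W))).degree v := by
  obtain ⟨u, hu, h⟩ := hC.exists_adj v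
  refine (SimpleGraph.degree_pos_iff_exists_adj _ v).2 ⟨u, ?_⟩
  rw [SimpleGraph.fromEdgeSet_adj]
  exact ⟨h, hu.symm⟩

theorem sum_degree_fromEdgeSet [Fintype W] {C : Finset (Sym2 W)}
    [DecidableRel (SimpleGraph.fromEdgeSet (C : Set (Sym2 W))).Adj]
    (hC : ∀ e ∈ C, e ∈ (⊤ : SimpleGraph W).edgeSet) :
    ∑ v, (SimpleGraph.fromEdgeSet (C : Set (Sym2 W))).degree v = 2 * #C := by
  classical
  rw [SimpleGraph.sum_degrees_eq_twice_card_edges]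
  congr 2
  ext e
  rw [← Finset.mem_coe, SimpleGraph.coe_edgeFinset, SimpleGraph.edgeSet_fromEdgeSet]
  simp only [Set.mem_sdiff, mem_coe]
  refine ⟨fun h => h.1, fun h => ⟨h, ?_⟩⟩
  have := hC e h
  rw [SimpleGraph.edgeSet_top] at this
  exact this

theorem card_le_two_mul_of_isEdgeCover [Fintype W] {C : Finset (Sym2 W)}
    (hC : IsEdgeCover (⊤ : SimpleGraph W) C) : Fintype.card W ≤ 2 * #C := by
  classical
  rw [← sum_degree_fromEdgeSet hC.1, ← Finset.card_univ, Finset.card_eq_sum_ones]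
  exact Finset.sum_le_sum fun v _ => one_le_degree_of_isEdgeCover hC v

/-- Join `2 i` to `2 i + 1`, and the last vertex to `0` if it is left over. -/
theorem exists_isEdgeCover (s : ℕ) : ∃ C : Finset (Sym2 (Fin (s + 2))),
    IsEdgeCover (⊤ : SimpleGraph (Fin (s + 2))) C ∧ #C ≤ (s + 3) / 2 := by
  let g : Fin ((s + 3) / 2) → Sym2 (Fin (s + 2)) := fun i =>
    s(⟨2 * i, by omega⟩, if h : 2 * i.1 + 1 < s + 2 then ⟨2 * i + 1, h⟩ else ⟨0, by omega⟩)
  refine ⟨univ.image g, ⟨?_, ?_⟩, Finset.card_image_le.trans (by simp)⟩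
  · intro e he
    obtain ⟨i, -, rfl⟩ := mem_image.1 he
    rw [SimpleGraph.mem_edgeSet, SimpleGraph.top_adj]
    split_ifs with h
    · simp [Fin.ext_iff]
    · simp only [ne_eq, Fin.ext_iff]
      omega
  · intro v
    refine ⟨g ⟨v / 2, by omega⟩, mem_image_of_mem _ (mem_univ _), ?_⟩
    rw [Sym2.mem_iff]
    rcases Nat.mod_two_eq_zero_or_one v with h | h
    · left
      ext
      simp only
      omega
    · right
      rw [dif_pos (by simp only; omega)]
      ext
      simp only
      omega

theorem isMinimumEdgeCover_iff {s : ℕ} {C : Finset (Sym2 (Fin (s + 2)))} :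
    IsMinimumEdgeCover (⊤ : SimpleGraph (Fin (s + 2))) C ↔
      IsEdgeCover (⊤ : SimpleGraph (Fin (s + 2))) C ∧ #C = (s + 3) / 2 := by
  constructor
  · intro h
    obtain ⟨C', hC', hle⟩ := exists_isEdgeCover s
    have h1 := h.2 C' hC'
    have h2 := card_le_two_mul_of_isEdgeCover h.1
    rw [Fintype.card_fin] at h2
    exact ⟨h.1, by omega⟩
  · rintro ⟨h, hc⟩
    refine ⟨h, fun C' hC' => ?_⟩
    have h2 := card_le_two_mul_of_isEdgeCover hC'
    rw [Fintype.card_fin] at h2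
    omega

theorem sum_degree_le_of_isMinimumEdgeCover {s : ℕ} {C : Finset (Sym2 (Fin (s + 2)))}
    [DecidableRel (SimpleGraph.fromEdgeSet (C : Set (Sym2 (Fin (s + 2))))).Adj]
    (hC : IsMinimumEdgeCover (⊤ : SimpleGraph (Fin (s + 2))) C) :
    ∑ v, (SimpleGraph.fromEdgeSet (C : Set (Sym2 (Fin (s + 2))))).degree v
      ≤ Fintype.card (Fin (s + 2)) + 1 := by
  have h := isMinimumEdgeCover_iff.1 hC
  rw [sum_degree_fromEdgeSet h.1.1, h.2, Fintype.card_fin]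
  omega

/-- The components of a minimum edge cover are single edges, apart from at most one path with two
edges: no two vertices lie on two edges each. -/
theorem eq_of_isMinimumEdgeCover {s : ℕ} {C : Finset (Sym2 (Fin (s + 2)))}
    (hC : IsMinimumEdgeCover (⊤ : SimpleGraph (Fin (s + 2))) C) {a a₁ a₂ b b₁ b₂ : Fin (s + 2)}
    (ha₁ : s(a, a₁) ∈ C) (ha₂ : s(a, a₂) ∈ C) (ha : a₁ ≠ a₂) (hb₁ : s(b, b₁) ∈ C)
    (hb₂ : s(b, b₂) ∈ C) (hb : b₁ ≠ b₂) : a = b := by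
  classical
  have key : ∀ {a a₁ a₂}, s(a, a₁) ∈ C → s(a, a₂) ∈ C → a₁ ≠ a₂ →
      2 ≤ (SimpleGraph.fromEdgeSet (C : Set (Sym2 (Fin (s + 2))))).degree a := by
    intro a a₁ a₂ h₁ h₂ hne
    rw [← SimpleGraph.card_neighborFinset_eq_degree]
    refine (Finset.card_pair hne).symm.trans_le (Finset.card_le_card fun x hx => ?_)
    have hx' : s(a, x) ∈ C := by
      simp only [mem_insert, mem_singleton] at hx
      rcases hx with rfl | rfl <;> assumption
    rw [SimpleGraph.mem_neighborFinset, SimpleGraph.fromEdgeSet_adj]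
    exact ⟨hx', by simpa using hC.1.1 _ hx'⟩
  exact eq_of_two_le_degree (one_le_degree_of_isEdgeCover hC.1)
    (sum_degree_le_of_isMinimumEdgeCover hC) (key ha₁ ha₂ ha) (key hb₁ hb₂ hb)

theorem exists_perm_of_isMinimumEdgeCover {s : ℕ} {C C' : Finset (Sym2 (Fin (s + 2)))}
    (hC : IsMinimumEdgeCover (⊤ : SimpleGraph (Fin (s + 2))) C)
    (hC' : IsMinimumEdgeCover (⊤ : SimpleGraph (Fin (s + 2))) C') :
    ∃ σ : Equiv.Perm (Fin (s + 2)), ∀ x y,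
      ((⊤ : SimpleGraph (Fin (s + 2))).deleteEdges (C' : Set (Sym2 (Fin (s + 2))))).Adj (σ x) (σ y)
        ↔ ((⊤ : SimpleGraph (Fin (s + 2))).deleteEdges (C : Set (Sym2 (Fin (s + 2))))).Adj x y := by
  classical
  obtain ⟨σ, hσ⟩ := exists_perm_adj_iff (one_le_degree_of_isEdgeCover hC.1)
    (sum_degree_le_of_isMinimumEdgeCover hC) (one_le_degree_of_isEdgeCover hC'.1)
    (sum_degree_le_of_isMinimumEdgeCover hC')
  refine ⟨σ, fun x y => ?_⟩
  have := hσ x y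
  simp only [SimpleGraph.fromEdgeSet_adj, SimpleGraph.deleteEdges_adj, SimpleGraph.top_adj,
    σ.injective.ne_iff] at this ⊢
  tauto

theorem choose_two_add_two (s : ℕ) :
    (s + 2).choose 2 = s * (s + 2) / 2 + (s + 3) / 2 := by
  rw [Nat.choose_two_right]
  have : (s + 2) * (s + 2 - 1) = s * (s + 2) + (s + 2) := by
    rw [show s + 2 - 1 = s + 1 by omega]
    ring
  have : s * (s + 2) % 2 = s % 2 := by
    rcases Nat.mod_two_eq_zero_or_one s with h | h <;> simp [Nat.mul_mod, h]
  omega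

theorem card_edgeFinset_deleteEdges {s : ℕ} {C : Finset (Sym2 (Fin (s + 2)))}
    (hC : IsMinimumEdgeCover (⊤ : SimpleGraph (Fin (s + 2))) C)
    [Fintype ((⊤ : SimpleGraph (Fin (s + 2))).deleteEdges
      (C : Set (Sym2 (Fin (s + 2))))).edgeSet] :
    #((⊤ : SimpleGraph (Fin (s + 2))).deleteEdges (C : Set (Sym2 (Fin (s + 2))))).edgeFinset
      = s * (s + 2) / 2 := by
  classical
  have h := isMinimumEdgeCover_iff.1 hC
  have h1 : ((⊤ : SimpleGraph (Fin (s + 2))).deleteEdges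
      (C : Set (Sym2 (Fin (s + 2))))).edgeFinset =
        (⊤ : SimpleGraph (Fin (s + 2))).edgeFinset \ C := by
    ext e
    simp
  rw [h1, Finset.card_sdiff_of_subset (fun e he => by
    rw [SimpleGraph.mem_edgeFinset]
    exact h.1.1 e he),
    SimpleGraph.card_edgeFinset_top_eq_card_choose_two, Fintype.card_fin, h.2,
    choose_two_add_two, Nat.add_sub_cancel]

end EdgeCover

/-! ### The cone -/

section Cone

variable {V W : Type*} [Fintype V] [DecidableEq V] {G : SimpleGraph W} {φ : W ↪ V}

theorem mem_cone {e : Finset V} : e ∈ cone G φ ↔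
    (∃ v, v ∉ Set.range φ ∧ ∃ a b, G.Adj a b ∧ e = {v, φ a, φ b}) ∨
      (#e = 3 ∧ ∀ x ∈ e, x ∈ Set.range φ) := by
  simp only [cone, mem_filter, mem_univ, true_and]
  constructor
  · rintro (⟨v, hv, a, b, h, rfl⟩ | h)
    · refine Or.inl ⟨v, hv, a, b, h, ?_⟩
      ext
      simp
    · exact Or.inr h
  · rintro (⟨v, hv, a, b, h, rfl⟩ | h)
    · refine Or.inl ⟨v, hv, a, b, h, ?_⟩
      ext
      simp
    · exact Or.inr h

omit [Fintype V] in
theorem card_insert_pair {v : V} (hv : v ∉ Set.range φ) {a b : W} (hab : a ≠ b) :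
    #({v, φ a, φ b} : Finset V) = 3 := by
  refine Finset.card_eq_three.2 ⟨v, φ a, φ b, ?_, ?_, by simpa, rfl⟩
  · exact fun h => hv ⟨a, h.symm⟩
  · exact fun h => hv ⟨b, h.symm⟩

theorem sized_cone : (cone G φ : Set (Finset V)).Sized 3 := by
  intro e he
  rcases mem_cone.1 (mem_coe.1 he) with ⟨v, hv, a, b, h, rfl⟩ | h
  · exact card_insert_pair hv h.ne
  · exact h.1

theorem card_cone [Fintype W] [Fintype G.edgeSet] : #(cone G φ) =
    #G.edgeFinset * (Fintype.card V - Fintype.card W) + (Fintype.card W).choose 3 := by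
  classical
  let R : Finset V := univ.map φ
  have hR : ∀ x, x ∈ R ↔ x ∈ Set.range φ := fun x => by simp [R]
  let T : Finset (Finset V) := G.edgeFinset.image fun e => (e.map φ).toFinset
  have hT : ∀ t ∈ T, t ⊆ R := by
    intro t ht x hx
    obtain ⟨e, -, rfl⟩ := mem_image.1 ht
    rw [Sym2.mem_toFinset, Sym2.mem_map] at hx
    obtain ⟨a, -, rfl⟩ := hx
    simp [R]
  have hTc : #T = #G.edgeFinset := by
    refine Finset.card_image_of_injective _ fun e e' h => ?_
    refine Sym2.map.injective φ.injective (Sym2.ext fun x => ?_)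
    rw [← Sym2.mem_toFinset, ← Sym2.mem_toFinset]
    exact (Finset.ext_iff.1 h) x
  -- The hyperedges with a vertex outside the core are `insert v t` with `v ∉ R` and `t ∈ T`.
  have hcone : cone G φ = ((Rᶜ ×ˢ T).image fun p => insert p.1 p.2) ∪ R.powersetCard 3 := by
    ext e
    simp only [mem_cone, mem_union, mem_image, mem_product, mem_compl, mem_powersetCard,
      Prod.exists, T, SimpleGraph.mem_edgeFinset, hR]
    refine or_congr ⟨?_, ?_⟩ ?_
    · rintro ⟨v, hv, a, b, h, rfl⟩
      refine ⟨v, _, ⟨hv, s(a, b), h, rfl⟩, ?_⟩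
      ext x
      simp [Sym2.mem_toFinset]
    · rintro ⟨v, _, ⟨hv, z, h, rfl⟩, rfl⟩
      induction z using Sym2.ind with
      | _ a b =>
        refine ⟨v, hv, a, b, h, ?_⟩
        ext x
        simp [Sym2.mem_toFinset]
    · rw [and_comm]
      refine and_congr_left fun _ => ?_
      exact ⟨fun h x hx => (hR x).2 (h x hx), fun h x hx => (hR x).1 (h hx)⟩
  have hdisj : Disjoint ((Rᶜ ×ˢ T).image fun p => insert p.1 p.2) (R.powersetCard 3) := by
    rw [Finset.disjoint_left]
    intro e he he'
    obtain ⟨⟨v, t⟩, hp, rfl⟩ := mem_image.1 he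
    exact (mem_compl.1 (mem_product.1 hp).1) ((mem_powersetCard.1 he').1 (mem_insert_self _ _))
  have hinj : Set.InjOn (fun p : V × Finset V => insert p.1 p.2) (Rᶜ ×ˢ T : Finset _) := by
    rintro ⟨v, t⟩ hp ⟨v', t'⟩ hp' h
    simp only [coe_product, Set.mem_prod, mem_coe, mem_compl] at hp hp' h
    have hv : ∀ {v v' t t'}, v ∉ R → t' ∈ T → insert v t = insert v' t' → v = v' :=
      fun {v v' t t'} hv ht' h => by
        have : v ∈ insert v' t' := h ▸ mem_insert_self v t
        exact (mem_insert.1 this).resolve_right fun hvt => hv (hT _ ht' hvt)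
    obtain rfl := hv hp.1 hp'.2 h
    rw [← Finset.erase_insert fun h' => hp.1 (hT _ hp.2 h'), h,
      Finset.erase_insert fun h' => hp.1 (hT _ hp'.2 h')]
  rw [hcone, Finset.card_union_of_disjoint hdisj, Finset.card_image_of_injOn hinj,
    Finset.card_product, Finset.card_powersetCard, Finset.card_compl, hTc, Finset.card_map,
    Finset.card_univ, mul_comm]

/-- An isomorphism of the core graphs, extended to the vertices, maps cone to cone. -/
theorem map_mem_cone {W' : Type*} {G' : SimpleGraph W'} {φ' : W' ↪ V} {σ : W ≃ W'}
    (hσ : ∀ x y, G.Adj x y → G'.Adj (σ x) (σ y)) {τ : V ≃ V} (hτ : ∀ a, τ (φ a) = φ' (σ a))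
    {e : Finset V} (he : e ∈ cone G φ) : e.map τ.toEmbedding ∈ cone G' φ' := by
  have hr : ∀ x, τ x ∈ Set.range φ' ↔ x ∈ Set.range φ := by
    intro x
    constructor
    · rintro ⟨b, hb⟩
      refine ⟨σ.symm b, τ.injective ?_⟩
      rw [hτ, σ.apply_symm_apply, hb]
    · rintro ⟨a, rfl⟩
      exact ⟨σ a, (hτ a).symm⟩
  rw [mem_cone] at he ⊢
  rcases he with ⟨v, hv, a, b, h, rfl⟩ | ⟨h3, h⟩
  · refine Or.inl ⟨τ v, mt (hr v).1 hv, σ a, σ b, hσ _ _ h, ?_⟩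
    simp [Finset.map_insert, hτ]
  · refine Or.inr ⟨by simpa using h3, ?_⟩
    intro x hx
    obtain ⟨y, hy, rfl⟩ := mem_map.1 hx
    exact (hr y).2 (h y hy)

theorem isomorphic_cone [Finite W] {G G' : SimpleGraph W} {φ φ' : W ↪ V} {σ : Equiv.Perm W}
    (hσ : ∀ x y, G'.Adj (σ x) (σ y) ↔ G.Adj x y) : Isomorphic (cone G φ) (cone G' φ') := by
  obtain ⟨τ, hτ⟩ : ∃ τ : Equiv.Perm V, ∀ a, τ (φ a) = φ' (σ a) := by
    classical
    let ε : {x // x ∈ Set.range φ} ≃ {x // x ∈ Set.range φ'} :=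
      (Equiv.ofInjective φ φ.injective).symm.trans
        (σ.trans (Equiv.ofInjective φ' φ'.injective))
    refine ⟨ε.extendSubtype, fun a => ?_⟩
    rw [Equiv.extendSubtype_apply_of_mem ε _ ⟨a, rfl⟩]
    have : (⟨φ a, ⟨a, rfl⟩⟩ : Set.range φ) = Equiv.ofInjective φ φ.injective a := rfl
    simp only [ε, Equiv.trans_apply]
    erw [this, Equiv.symm_apply_apply]
    rfl
  refine ⟨τ, fun e => ⟨fun h => ?_, map_mem_cone (fun x y => (hσ x y).2) hτ⟩⟩
  have h' := map_mem_cone (G' := G) (φ' := φ) (σ := σ.symm) (τ := τ.symm)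
    (fun x y hxy => (hσ _ _).1 (by simpa using hxy)) (fun a => by
      rw [Equiv.symm_apply_eq, hτ, σ.apply_symm_apply]) h
  simpa [Finset.map_map] using h'

/-- At most one vertex of a hyperedge of the cone lies outside the core `φ(W)`. -/
theorem mem_range_or_mem_range_of_mem_cone {e : Finset V} (he : e ∈ cone G φ) {x y : V}
    (hx : x ∈ e) (hy : y ∈ e) (hxy : x ≠ y) : x ∈ Set.range φ ∨ y ∈ Set.range φ := by
  rcases mem_cone.1 he with ⟨v, hv, a, b, h, rfl⟩ | h
  · simp only [mem_insert, mem_singleton] at hx hy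
    rcases hx with rfl | rfl | rfl
    · rcases hy with rfl | rfl | rfl
      · exact absurd rfl hxy
      · exact Or.inr ⟨a, rfl⟩
      · exact Or.inr ⟨b, rfl⟩
    · exact Or.inl ⟨a, rfl⟩
    · exact Or.inl ⟨b, rfl⟩
  · exact Or.inl (h.2 x hx)

/-- Each hyperedge of the cone has at least two vertices in the core `φ(W)`. If the cone contained
`M_{s+1}` as a trace, then the `s + 1` disjoint pairs would each use a core vertex, leaving only one
more; all the third vertices would have to be that one, and it would be adjacent in `G` to the whole
rest of the core. -/
theorem not_containsAsTrace_cone [Fintype W] {s : ℕ} (hs : 1 ≤ s) (hW : Fintype.card W = s + 2)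
    (hG : ∀ a, ∃ b, b ≠ a ∧ ¬ G.Adj a b) :
    ¬ ContainsAsTrace (cone G φ) (matching (s + 1)) := by
  intro hcon
  obtain ⟨a, b, c, hH, hab, hca, hcb⟩ := exists_of_containsAsTrace_matching sized_cone hcon
  -- Order each pair so that its first vertex lies in the core `φ(W)`.
  obtain ⟨a, b, hH, hab, hca, hcb, haR⟩ : ∃ a b : Fin (s + 1) → V,
      (∀ i, {a i, b i, c i} ∈ cone G φ) ∧ Function.Injective (Sum.elim a b) ∧
      (∀ i j, c i ≠ a j) ∧ (∀ i j, c i ≠ b j) ∧ ∀ i, a i ∈ Set.range φ := by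
    classical
    have hne : ∀ i, a i ≠ b i := fun i h => by
      have := @hab (.inl i) (.inr i) h
      simp at this
    have hor : ∀ i, a i ∈ Set.range φ ∨ b i ∈ Set.range φ := fun i =>
      mem_range_or_mem_range_of_mem_cone (hH i) (by simp) (by simp) (hne i)
    refine ⟨fun i => if a i ∈ Set.range φ then a i else b i,
      fun i => if a i ∈ Set.range φ then b i else a i, ?_, ?_, ?_, ?_, ?_⟩
    · intro i
      dsimp only
      split_ifs
      · exact hH i
      · rw [Finset.insert_comm]
        exact hH i
    · have haa : ∀ {i j}, a i = a j → i = j := fun {i j} h => by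
        simpa using @hab (.inl i) (.inl j) h
      have hbb : ∀ {i j}, b i = b j → i = j := fun {i j} h => by
        simpa using @hab (.inr i) (.inr j) h
      have hab' : ∀ {i j}, a i ≠ b j := fun {i j} h => by
        simpa using @hab (.inl i) (.inr j) h
      rintro (i | i) (j | j) h <;> simp only [Sum.elim_inl, Sum.elim_inr] at h <;>
        split_ifs at h <;> first
          | rw [haa h] | rw [hbb h] | exact absurd h hab' | exact absurd h.symm hab'
      all_goals first
        | (obtain rfl := haa h; contradiction) | (obtain rfl := hbb h; contradiction)
    · intro i j
      dsimp only
      split_ifs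
      · exact hca i j
      · exact hcb i j
    · intro i j
      dsimp only
      split_ifs
      · exact hcb i j
      · exact hca i j
    · intro i
      dsimp only
      split_ifs with h
      · exact h
      · exact (hor i).resolve_left h
  clear hcon
  choose x hx using haR
  have haa : Function.Injective a := fun i j h => by
    simpa using @hab (.inl i) (.inl j) h
  have hbb : Function.Injective b := fun i j h => by
    simpa using @hab (.inr i) (.inr j) h
  have hab' : ∀ i j, a i ≠ b j := fun i j h => by
    simpa using @hab (.inl i) (.inr j) h
  have hxinj : Function.Injective x := fun i j h => haa (by rw [← hx, ← hx, h])
  -- Only one vertex of the core is not of the form `a i`.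
  have hrest : ∀ u u', (∀ i, x i ≠ u) → (∀ i, x i ≠ u') → u = u' := by
    classical
    have h1 : #((univ.image x)ᶜ) ≤ 1 := by
      rw [Finset.card_compl, Finset.card_image_of_injective _ hxinj, Finset.card_univ, hW,
        Fintype.card_fin]
      omega
    intro u u' hu hu'
    exact Finset.card_le_one.1 h1 u (by simpa using hu) u' (by simpa using hu')
  have hbc : ∀ i, b i ∈ Set.range φ ∨ c i ∈ Set.range φ := fun i =>
    mem_range_or_mem_range_of_mem_cone (hH i) (by simp) (by simp) (hcb i i).symm
  have hbx : ∀ i u, φ u = b i → ∀ j, x j ≠ u := fun i u h j hj =>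
    hab' j i (by rw [← hx, hj, h])
  have hcx : ∀ i u, φ u = c i → ∀ j, x j ≠ u := fun i u h j hj =>
    hca i j (by rw [← hx j, hj, h])
  have hc : ∀ i, c i ∈ Set.range φ := by
    intro i
    refine (hbc i).resolve_left fun ⟨u, hu⟩ => ?_
    obtain ⟨j, hj⟩ : ∃ j : Fin (s + 1), j ≠ i := by
      have : Nontrivial (Fin (s + 1)) := Fin.nontrivial_iff_two_le.2 (by omega)
      exact exists_ne i
    rcases hbc j with ⟨u', hu'⟩ | ⟨u', hu'⟩
    · have := hrest u u' (hbx i u hu) (hbx j u' hu')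
      subst this
      exact hj (hbb (hu'.symm.trans hu))
    · have := hrest u u' (hbx i u hu) (hcx j u' hu')
      subst this
      exact hcb j i (hu'.symm.trans hu)
  choose y hy using hc
  obtain ⟨u, hu⟩ : ∃ u, ∀ i, y i = u :=
    ⟨y 0, fun i => hrest _ _ (hcx i _ (hy i)) (hcx 0 _ (hy 0))⟩
  -- So `u` is the common third vertex of all the hyperedges, adjacent to the whole core.
  obtain ⟨w, hwu, hw⟩ := hG u
  obtain ⟨i, hi⟩ : ∃ i, x i = w := by
    by_contra! h
    exact hwu (hrest w u h (hu 0 ▸ hcx 0 _ (hy 0)))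
  have hbR : b i ∉ Set.range φ := by
    rintro ⟨u', hu'⟩
    have := hrest u' (y i) (hbx i u' hu') (hcx i _ (hy i))
    subst this
    exact hcb i i ((hy i).symm.trans hu')
  have hmem := hH i
  rw [← hx, ← hy, hu, hi] at hmem
  rcases mem_cone.1 hmem with ⟨v, hv, p, q, hpq, h⟩ | h
  · have hpm : ∀ {r}, φ r ∈ ({v, φ p, φ q} : Finset V) → r = p ∨ r = q := fun {r} hr => by
      simp only [mem_insert, mem_singleton, φ.injective.eq_iff] at hr
      exact hr.resolve_left fun h => hv ⟨r, h⟩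
    have h1 := hpm (r := w) (h ▸ by simp)
    have h2 := hpm (r := u) (h ▸ by simp)
    rcases h1 with rfl | rfl <;> rcases h2 with rfl | rfl
    · exact hwu rfl
    · exact hw hpq.symm
    · exact hw hpq
    · exact hwu rfl
  · exact hbR (h.2 _ (by simp))

end Cone

/-! ### Heavy pairs and light hyperedges -/

section Heavy

variable {V : Type*} [Fintype V] [DecidableEq V] {H : Finset (Finset V)} {K s : ℕ}

/-- The vertices that complete `x`, `y` to a hyperedge of `H`. -/
def link (H : Finset (Finset V)) (x y : V) : Finset V :=
  {z | {x, y, z} ∈ H}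

theorem mem_link {x y z : V} : z ∈ link H x y ↔ {x, y, z} ∈ H := by
  simp [link]

theorem link_comm (x y : V) : link H x y = link H y x := by
  ext z
  rw [mem_link, mem_link, Finset.insert_comm]

/-- The graph of the pairs of vertices contained in at least `K` hyperedges (for 3-uniform `H`, the
size of `link H x y` is the codegree of `x ≠ y`). -/
def heavyGraph (H : Finset (Finset V)) (K : ℕ) : SimpleGraph V where
  Adj x y := x ≠ y ∧ K ≤ #(link H x y)
  symm := ⟨fun x y h => ⟨h.1.symm, link_comm (H := H) x y ▸ h.2⟩⟩
  loopless := ⟨fun _ h => h.1 rfl⟩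

/-- Pairs with large links can be completed to hyperedges by distinct new vertices outside any given
small set. This is an instance of Hall's theorem, as each link is larger than the index type. -/
theorem exists_injective_completion {ι : Type*} [Fintype ι] (x y : ι → V) (B : Finset V)
    (h : ∀ i, #B + Fintype.card ι ≤ #(link H (x i) (y i))) :
    ∃ z : ι → V, Function.Injective z ∧ (∀ i, z i ∉ B) ∧ ∀ i, {x i, z i, y i} ∈ H := by
  obtain ⟨z, hz, h⟩ := (Finset.all_card_le_biUnion_card_iff_exists_injective
    fun i => link H (x i) (y i) \ B).1 (by
      intro J
      rcases J.eq_empty_or_nonempty with rfl | ⟨i, hi⟩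
      · simp
      have h1 := Finset.card_le_card (Finset.subset_biUnion_of_mem
        (fun i => link H (x i) (y i) \ B) hi)
      have h2 := Finset.le_card_sdiff B (link H (x i) (y i))
      have h3 := Finset.card_le_univ J
      have h4 := h i
      omega)
  refine ⟨z, hz, fun i => (mem_sdiff.1 (h i)).2, fun i => ?_⟩
  have := mem_link.1 (mem_sdiff.1 (h i)).1
  rwa [Finset.pair_comm]

/-- Let each `x ∈ X` have the heavy neighbour `y x ∉ X`. The pairs `{x, z x}` of hyperedges
`{x, z x, y x}`, with new vertices `z x`, form a matching in the trace. -/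
theorem containsAsTrace_of_escaping (hK : 3 * (s + 1) ≤ K) {X : Finset V} (hX : #X = s + 1)
    (h : Escaping (heavyGraph H K) X) : ContainsAsTrace H (matching (s + 1)) := by
  have h' : ∀ x : X, ∃ y, y ∉ X ∧ (heavyGraph H K).Adj x y := fun x => h x x.2
  choose y hyX hy using h'
  have hB : #(X ∪ univ.image y) ≤ (s + 1) + (s + 1) := by
    refine (Finset.card_union_le _ _).trans (Nat.add_le_add hX.le ?_)
    exact Finset.card_image_le.trans (by simp [hX])
  obtain ⟨z, hz, hzB, hzH⟩ := exists_injective_completion (H := H) (fun x : X => x.1) y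
    (X ∪ univ.image y) (fun i => by
      have := (hy i).2
      rw [Fintype.card_coe, hX]
      omega)
  simp only [mem_union, mem_image, mem_univ, true_and, not_or, not_exists] at hzB
  have := containsAsTrace_matching_of (H := H) (fun x : X => x.1) z y hzH ?_ ?_ ?_
  · rwa [Fintype.card_coe, hX] at this
  · refine Function.Injective.sumElim Subtype.val_injective hz fun i j h => (hzB j).1 ?_
    exact h ▸ i.2
  · exact fun i j h => hyX i (h ▸ j.2)
  · exact fun i j h => (hzB j).2 i h

/-- The pairs from a set `X` of `s` vertices with heavy neighbours outside are completed to
`M_{s+1}` by the pair `{p, q}` of one further hyperedge, whose third vertex is `r`. -/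
theorem containsAsTrace_of_insert (hK : 3 * (s + 1) ≤ K) {X : Finset V} (hX : #X = s)
    {p q r : V} (hH : {p, q, r} ∈ H) (hpq : p ≠ q) (hpr : p ≠ r) (hqr : q ≠ r) (hpX : p ∉ X)
    (hqX : q ∉ X) (hrX : r ∉ X)
    (h : ∀ x ∈ X, ∃ y, y ∉ X ∧ y ≠ p ∧ y ≠ q ∧ (heavyGraph H K).Adj x y) :
    ContainsAsTrace H (matching (s + 1)) := by
  have h' : ∀ x : X, ∃ y, y ∉ X ∧ y ≠ p ∧ y ≠ q ∧ (heavyGraph H K).Adj x y := fun x => h x x.2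
  choose y hyX hyp hyq hy using h'
  have hB : #({p, q, r} ∪ (X ∪ univ.image y)) ≤ 3 + (s + s) := by
    refine (Finset.card_union_le _ _).trans (Nat.add_le_add Finset.card_le_three ?_)
    refine (Finset.card_union_le _ _).trans (Nat.add_le_add hX.le ?_)
    exact Finset.card_image_le.trans (by simp [hX])
  obtain ⟨z, hz, hzB, hzH⟩ := exists_injective_completion (H := H) (fun x : X => x.1) y
    ({p, q, r} ∪ (X ∪ univ.image y)) (fun i => by
      have := (hy i).2
      rw [Fintype.card_coe, hX]
      omega)
  simp only [mem_union, mem_image, mem_univ, true_and, not_or, not_exists, mem_insert,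
    mem_singleton] at hzB
  have := containsAsTrace_matching_of (H := H) (ι := Option X) (fun o => o.elim p fun x => x.1)
    (fun o => o.elim q z) (fun o => o.elim r y) ?_ ?_ ?_ ?_
  · rwa [Fintype.card_option, Fintype.card_coe, hX] at this
  · rintro (_ | i)
    · exact hH
    · exact hzH i
  · refine Function.Injective.sumElim ?_ ?_ ?_
    · rintro (_ | i) (_ | j) h <;> simp only [Option.elim] at h
      · rfl
      · exact absurd j.2 (h ▸ hpX)
      · exact absurd i.2 (h ▸ hpX)
      · rw [Subtype.ext h]
    · rintro (_ | i) (_ | j) h <;> simp only [Option.elim] at h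
      · rfl
      · exact absurd h.symm (hzB j).1.2.1
      · exact absurd h (hzB i).1.2.1
      · rw [hz h]
    · rintro (_ | i) (_ | j) h <;> simp only [Option.elim] at h
      · exact hpq h
      · exact (hzB j).1.1 h.symm
      · exact hqX (h ▸ i.2)
      · exact (hzB j).2.1 (h ▸ i.2)
  · rintro (_ | i) (_ | j) h <;> simp only [Option.elim] at h
    · exact hpr h.symm
    · exact hrX (h ▸ j.2)
    · exact hyp i h
    · exact hyX i (h ▸ j.2)
  · rintro (_ | i) (_ | j) h <;> simp only [Option.elim] at h
    · exact hqr h.symm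
    · exact (hzB j).1.2.2 h.symm
    · exact hyq i h
    · exact (hzB j).2.2 i h

end Heavy

section Light

variable {V : Type*} [DecidableEq V]

/-- A large family of bounded sets in which all degrees are bounded contains many disjoint members:
the members that meet `m` given ones are at most `m k D`. -/
theorem exists_pairwiseDisjoint {F : Finset (Finset V)} {k D : ℕ} (hne : ∀ e ∈ F, e.Nonempty)
    (hk : ∀ e ∈ F, #e ≤ k) (hD : ∀ v, #{e ∈ F | v ∈ e} ≤ D) (m : ℕ) (hF : m * k * D < #F) :
    ∃ M ⊆ F, #M = m + 1 ∧ (M : Set (Finset V)).PairwiseDisjoint id := by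
  induction m with
  | zero =>
    obtain ⟨e, he⟩ := Finset.card_pos.1 (Nat.zero_lt_of_lt hF)
    exact ⟨{e}, by simpa using he, by simp, by simp⟩
  | succ m ih =>
    obtain ⟨M, hMF, hM, hdisj⟩ := ih (lt_of_le_of_lt (by gcongr; omega) hF)
    have hU : #(M.biUnion id) ≤ (m + 1) * k := by
      rw [← hM]
      exact Finset.card_biUnion_le_card_mul _ _ _ fun e he => hk e (hMF he)
    obtain ⟨e, heF, he⟩ : ∃ e ∈ F, Disjoint e (M.biUnion id) := by
      by_contra! hcon
      have hsub : F ⊆ (M.biUnion id).biUnion fun v => {e ∈ F | v ∈ e} := by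
        intro e he
        obtain ⟨v, hv, hvU⟩ := Finset.not_disjoint_iff.1 (hcon e he)
        exact mem_biUnion.2 ⟨v, hvU, mem_filter.2 ⟨he, hv⟩⟩
      have h1 := (Finset.card_le_card hsub).trans
        (Finset.card_biUnion_le_card_mul _ _ D fun v _ => hD v)
      have h2 := Nat.mul_le_mul_right D hU
      omega
    have heM : ∀ t ∈ M, Disjoint e t := fun t ht =>
      he.mono_right (Finset.subset_biUnion_of_mem id ht)
    have heM' : e ∉ M := fun h => (hne e heF).ne_empty (disjoint_self.1 (heM e h))
    refine ⟨insert e M, Finset.insert_subset heF hMF, by rw [Finset.card_insert_of_notMem heM', hM],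
      ?_⟩
    rw [Finset.coe_insert]
    exact hdisj.insert fun t ht _ => heM t ht

theorem injective_sumElim_of_pairwiseDisjoint {M : Finset (Finset V)} {a b : M → V}
    (hM : (M : Set (Finset V)).PairwiseDisjoint id) (ha : ∀ t : M, a t ∈ t.1)
    (hb : ∀ t : M, b t ∈ t.1) (hab : ∀ t, a t ≠ b t) : Function.Injective (Sum.elim a b) := by
  have key : ∀ (t t' : M) (x : V), x ∈ t.1 → x ∈ t'.1 → t = t' := fun t t' x hx hx' => by
    by_contra h
    exact Finset.disjoint_left.1 (hM t.2 t'.2 fun h' => h (Subtype.ext h')) hx hx'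
  refine Function.Injective.sumElim (fun t t' h => ?_) (fun t t' h => ?_) fun t t' h => ?_
  · exact key t t' _ (ha t) (h ▸ ha t')
  · exact key t t' _ (hb t) (h ▸ hb t')
  · obtain rfl := key t t' _ (ha t) (h ▸ hb t')
    exact hab t h

variable [Fintype V] {H : Finset (Finset V)} {K s : ℕ}

open Classical in
/-- The hyperedges that contain no heavy pair. -/
noncomputable def light (H : Finset (Finset V)) (K : ℕ) : Finset (Finset V) :=
  {e ∈ H | ∀ x ∈ e, ∀ y ∈ e, ¬ (heavyGraph H K).Adj x y}

theorem mem_light {e : Finset V} :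
    e ∈ light H K ↔ e ∈ H ∧ ∀ x ∈ e, ∀ y ∈ e, ¬ (heavyGraph H K).Adj x y := by
  simp [light]

/-- A vertex `v` of large degree in the light hyperedges has a large matching in its link, which is
the trace of hyperedges with the common third vertex `v`. -/
theorem card_light_le_of_mem (hH : (H : Set (Finset V)).Sized 3)
    (htr : ¬ ContainsAsTrace H (matching (s + 1))) (v : V) :
    #{e ∈ light H K | v ∈ e} ≤ s * 2 * K := by
  by_contra! hlt
  let F := ({e ∈ light H K | v ∈ e}).image fun e => e.erase v
  have hmem : ∀ {t}, t ∈ F → v ∉ t ∧ #t = 2 ∧ insert v t ∈ light H K := by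
    intro t ht
    obtain ⟨e, he, rfl⟩ := mem_image.1 ht
    rw [mem_filter] at he
    have h3 : #e = 3 := hH (mem_light.1 he.1).1
    refine ⟨Finset.notMem_erase v e, by rw [Finset.card_erase_of_mem he.2, h3], ?_⟩
    rw [Finset.insert_erase he.2]
    exact he.1
  have hFc : #F = #{e ∈ light H K | v ∈ e} := by
    refine Finset.card_image_of_injOn fun e he e' he' h => ?_
    rw [← Finset.insert_erase (mem_filter.1 he).2, ← Finset.insert_erase (mem_filter.1 he').2]
    exact congrArg (insert v) h
  have hdeg : ∀ u, #{t ∈ F | u ∈ t} ≤ K := by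
    intro u
    rcases Finset.eq_empty_or_nonempty {t ∈ F | u ∈ t} with h0 | ⟨t₀, ht₀⟩
    · simp [h0]
    rw [mem_filter] at ht₀
    have hvu : v ≠ u := fun h => (hmem ht₀.1).1 (h ▸ ht₀.2)
    have hnot := (mem_light.1 (hmem ht₀.1).2.2).2 v (mem_insert_self _ _) u
      (mem_insert_of_mem ht₀.2)
    have hlink : #(link H v u) ≤ K := by
      by_contra! hK
      exact hnot ⟨hvu, hK.le⟩
    refine le_trans (Finset.card_le_card (t := (link H v u).image fun z => {u, z}) ?_)
      (Finset.card_image_le.trans hlink)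
    intro t ht
    rw [mem_filter] at ht
    obtain ⟨-, h2, hl⟩ := hmem ht.1
    obtain ⟨z, hz⟩ := Finset.card_eq_one.1 (show #(t.erase u) = 1 by
      rw [Finset.card_erase_of_mem ht.2, h2])
    have htz : t = {u, z} := by rw [← Finset.insert_erase ht.2, hz]
    refine mem_image.2 ⟨z, mem_link.2 ?_, htz.symm⟩
    rw [← htz]
    exact (mem_light.1 hl).1
  obtain ⟨M, hMF, hM, hdisj⟩ := exists_pairwiseDisjoint
    (fun t ht => Finset.card_pos.1 (by rw [(hmem ht).2.1]; omega)) (fun t ht => (hmem ht).2.1.le)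
    hdeg s (hFc ▸ hlt)
  have hpair : ∀ t : M, ∃ a b, a ≠ b ∧ t.1 = {a, b} := fun t =>
    Finset.card_eq_two.1 (hmem (hMF t.2)).2.1
  choose a b hab ht using hpair
  have ha : ∀ t : M, a t ∈ t.1 := fun t => by rw [ht]; simp
  have hb : ∀ t : M, b t ∈ t.1 := fun t => by rw [ht]; simp
  refine htr ?_
  rw [← hM, ← Fintype.card_coe]
  refine containsAsTrace_matching_of a b (fun _ => v) (fun t => ?_)
    (injective_sumElim_of_pairwiseDisjoint hdisj ha hb hab) ?_ ?_
  · have := (mem_light.1 (hmem (hMF t.2)).2.2).1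
    convert this using 1
    rw [ht]
    ext x
    simp only [mem_insert, mem_singleton]
    tauto
  · exact fun _ t h => (hmem (hMF t.2)).1 (h ▸ ha t)
  · exact fun _ t h => (hmem (hMF t.2)).1 (h ▸ hb t)

/-- With bounded degrees, many light hyperedges include `s + 1` disjoint ones. -/
theorem card_light_le (hH : (H : Set (Finset V)).Sized 3)
    (htr : ¬ ContainsAsTrace H (matching (s + 1))) : #(light H K) ≤ s * 3 * (s * 2 * K) := by
  by_contra! hlt
  have h3 : ∀ e ∈ light H K, #e = 3 := fun e he => hH (mem_light.1 he).1
  obtain ⟨M, hMF, hM, hdisj⟩ := exists_pairwiseDisjoint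
    (fun t ht => Finset.card_pos.1 (by rw [h3 t ht]; omega)) (fun t ht => (h3 t ht).le)
    (card_light_le_of_mem hH htr) s hlt
  have hpair : ∀ t : M, ∃ a b c, a ≠ b ∧ a ≠ c ∧ b ≠ c ∧ t.1 = {a, b, c} := fun t =>
    Finset.card_eq_three.1 (h3 t (hMF t.2))
  choose a b c hab hac hbc ht using hpair
  have ha : ∀ t : M, a t ∈ t.1 := fun t => by rw [ht]; simp
  have hb : ∀ t : M, b t ∈ t.1 := fun t => by rw [ht]; simp
  have hc : ∀ t : M, c t ∈ t.1 := fun t => by rw [ht]; simp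
  refine htr ?_
  rw [← hM, ← Fintype.card_coe]
  refine containsAsTrace_matching_of a b c (fun t => ?_)
    (injective_sumElim_of_pairwiseDisjoint hdisj ha hb hab) (fun t t' h => ?_) (fun t t' h => ?_)
  · rw [← ht]
    exact (mem_light.1 (hMF t.2)).1
  · have := @injective_sumElim_of_pairwiseDisjoint _ _ M a c hdisj ha hc hac
      (.inl t') (.inr t) h.symm
    simp at this
  · have := @injective_sumElim_of_pairwiseDisjoint _ _ M b c hdisj hb hc hbc
      (.inl t') (.inr t) h.symm
    simp at this

theorem card_le_add_card_light (hH : (H : Set (Finset V)).Sized 3)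
    [Fintype (heavyGraph H K).edgeSet] :
    #H ≤ #(heavyGraph H K).edgeFinset * Fintype.card V + #(light H K) := by
  have hsub : H ⊆ ((heavyGraph H K).edgeFinset.biUnion fun e =>
      univ.image fun z => insert z e.toFinset) ∪ light H K := by
    intro e he
    by_cases hl : e ∈ light H K
    · exact mem_union_right _ hl
    have : ∃ x ∈ e, ∃ y ∈ e, (heavyGraph H K).Adj x y := by
      by_contra! h
      exact hl (mem_light.2 ⟨he, h⟩)
    obtain ⟨x, hx, y, hy, hxy⟩ := this
    have hy' : y ∈ e.erase x := mem_erase.2 ⟨hxy.ne.symm, hy⟩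
    obtain ⟨z, hz⟩ := Finset.card_eq_one.1 (show #((e.erase x).erase y) = 1 by
      have h3 : #e = 3 := hH he
      rw [Finset.card_erase_of_mem hy', Finset.card_erase_of_mem hx, h3])
    refine mem_union_left _ (mem_biUnion.2 ⟨s(x, y), by simpa using hxy,
      mem_image.2 ⟨z, mem_univ z, ?_⟩⟩)
    rw [← Finset.insert_erase hx, ← Finset.insert_erase hy', hz]
    ext w
    simp only [mem_insert, Sym2.mem_toFinset, Sym2.mem_iff, mem_singleton]
    tauto
  refine (Finset.card_le_card hsub).trans ((Finset.card_union_le _ _).trans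
    (Nat.add_le_add_right ?_ _))
  exact Finset.card_biUnion_le_card_mul _ _ _ fun e _ => Finset.card_image_le

end Light

/-! ### Extremal hypergraphs -/

section Structure

variable {V : Type*} [Fintype V] [DecidableEq V] {H : Finset (Finset V)} {K s : ℕ}
  {C : Finset (Sym2 (Fin (s + 2)))} {φ : Fin (s + 2) ↪ V}

/-- Suppose that the pairs inside the core `φ(Fin (s + 2))` that are not in `C` are heavy. A
hyperedge `{p, q, r}` meeting the core at most in `φ a` and `φ b` yields `M_{s+1}`, if each of the
other `s` core vertices is joined by a heavy pair to one of `φ a`, `φ b` that is not in the pair `{p, q}`. -/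
theorem containsAsTrace_of_core (hK : 3 * (s + 1) ≤ K)
    (hheavy : ∀ a b, a ≠ b → s(a, b) ∉ C → (heavyGraph H K).Adj (φ a) (φ b))
    {p q r : V} (hH : {p, q, r} ∈ H) (hpq : p ≠ q) (hpr : p ≠ r) (hqr : q ≠ r)
    {a b : Fin (s + 2)} (hab : a ≠ b) (hp : ∀ x, φ x = p → x = a ∨ x = b)
    (hq : ∀ x, φ x = q → x = a ∨ x = b) (hr : ∀ x, φ x = r → x = a ∨ x = b)
    (h : ∀ x, x ≠ a → x ≠ b → (s(x, a) ∉ C ∧ φ a ≠ p ∧ φ a ≠ q) ∨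
      (s(x, b) ∉ C ∧ φ b ≠ p ∧ φ b ≠ q)) : ContainsAsTrace H (matching (s + 1)) := by
  have hnot : ∀ {v}, (∀ x, φ x = v → x = a ∨ x = b) → v ∉ ((univ.erase a).erase b).map φ := by
    intro v hv h
    obtain ⟨x, hx, hxv⟩ := mem_map.1 h
    simp only [mem_erase, mem_univ, and_true] at hx
    exact (hv x hxv).elim hx.2 hx.1
  refine containsAsTrace_of_insert hK (X := ((univ.erase a).erase b).map φ) ?_ hH hpq hpr hqr
    (hnot hp) (hnot hq) (hnot hr) ?_
  · rw [Finset.card_map, Finset.card_erase_of_mem (by simp [hab.symm]),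
      Finset.card_erase_of_mem (mem_univ a), Finset.card_univ, Fintype.card_fin]
    omega
  · intro v hv
    obtain ⟨x, hx, rfl⟩ := mem_map.1 hv
    simp only [mem_erase, mem_univ, and_true] at hx
    rcases h x hx.2 hx.1 with h | h
    · exact ⟨φ a, by simp, h.2.1, h.2.2, hheavy x a hx.2 h.1⟩
    · exact ⟨φ b, by simp, h.2.1, h.2.2, hheavy x b hx.1 h.1⟩

/-- A hyperedge with exactly two vertices in the core, forming an edge of `C`: one of them, `b`, is
a leaf of `C`, so all the other core vertices are joined to it, and it serves as the third vertex. -/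
theorem containsAsTrace_of_two_core (hK : 3 * (s + 1) ≤ K)
    (hC : IsMinimumEdgeCover (⊤ : SimpleGraph (Fin (s + 2))) C)
    (hheavy : ∀ a b, a ≠ b → s(a, b) ∉ C → (heavyGraph H K).Adj (φ a) (φ b))
    {v : V} (hv : v ∉ Set.range φ) {a b : Fin (s + 2)} (hab : s(a, b) ∈ C)
    (hH : {v, φ a, φ b} ∈ H) : ContainsAsTrace H (matching (s + 1)) := by
  have hne : a ≠ b := by simpa using hC.1.1 _ hab
  -- By symmetry `b` lies on no other edge of `C`.
  wlog hb : ∀ x, s(x, b) ∈ C → x = a generalizing a b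
  · refine this (a := b) (b := a) (Sym2.eq_swap ▸ hab) (Finset.pair_comm (φ a) (φ b) ▸ hH) hne.symm
      fun x hx => ?_
    push Not at hb
    obtain ⟨y, hy, hya⟩ := hb
    by_contra hxb
    rw [Sym2.eq_swap] at hx hy
    exact hne (eq_of_isMinimumEdgeCover hC hx hab hxb hy (Sym2.eq_swap ▸ hab) hya)
  have hva : ∀ x, φ x ≠ v := fun x h => hv ⟨x, h⟩
  refine containsAsTrace_of_core hK hheavy hH (hva a).symm (hva b).symm (by simpa) hne
    (fun x hx => absurd hx (hva x)) (fun x hx => Or.inl (φ.injective hx))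
    (fun x hx => Or.inr (φ.injective hx)) fun x hxa _ => Or.inr ⟨fun h => hxa (hb x h), hva b, ?_⟩
  simpa using hne.symm

/-- A hyperedge with at most one vertex `φ a` in the core: for an edge `ab` of `C`, no third vertex
is joined in `C` to both `a` and `b`, so `φ a` and `φ b` together dominate the core. -/
theorem containsAsTrace_of_one_core (hK : 3 * (s + 1) ≤ K)
    (hC : IsMinimumEdgeCover (⊤ : SimpleGraph (Fin (s + 2))) C)
    (hheavy : ∀ a b, a ≠ b → s(a, b) ∉ C → (heavyGraph H K).Adj (φ a) (φ b))
    {p q r : V} (hH : {p, q, r} ∈ H) (hpq : p ≠ q) (hpr : p ≠ r) (hqr : q ≠ r)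
    (hp : p ∉ Set.range φ) (hq : q ∉ Set.range φ) : ContainsAsTrace H (matching (s + 1)) := by
  obtain ⟨a, ha⟩ : ∃ a, ∀ x, φ x = r → x = a := by
    by_cases hr : r ∈ Set.range φ
    · obtain ⟨a, rfl⟩ := hr
      exact ⟨a, fun x hx => φ.injective hx⟩
    · exact ⟨0, fun x hx => absurd ⟨x, hx⟩ hr⟩
  obtain ⟨b, hba, hb⟩ := hC.1.exists_adj a
  have hp' : ∀ x, φ x ≠ p := fun x h => hp ⟨x, h⟩
  have hq' : ∀ x, φ x ≠ q := fun x h => hq ⟨x, h⟩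
  refine containsAsTrace_of_core hK hheavy hH hpq hpr hqr hba.symm (fun x h => absurd h (hp' x))
    (fun x h => absurd h (hq' x)) (fun x h => Or.inl (ha x h)) fun x hxa hxb => ?_
  by_cases hx : s(x, a) ∈ C
  · refine Or.inr ⟨fun hx' => hba ?_, hp' b, hq' b⟩
    rw [Sym2.eq_swap] at hx hx'
    exact eq_of_isMinimumEdgeCover hC hx' (Sym2.eq_swap ▸ hb) hxa hx hb hxb
  · exact Or.inl ⟨hx, hp' a, hq' a⟩

/-- If the heavy pairs contain an extremal graph, then the hypergraph lies in its cone. -/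
theorem subset_cone (hH : (H : Set (Finset V)).Sized 3)
    (htr : ¬ ContainsAsTrace H (matching (s + 1))) (hK : 3 * (s + 1) ≤ K)
    (hC : IsMinimumEdgeCover (⊤ : SimpleGraph (Fin (s + 2))) C)
    (hheavy : ∀ a b, a ≠ b → s(a, b) ∉ C → (heavyGraph H K).Adj (φ a) (φ b)) :
    H ⊆ cone ((⊤ : SimpleGraph (Fin (s + 2))).deleteEdges (C : Set (Sym2 (Fin (s + 2))))) φ := by
  intro e he
  have h3 : #e = 3 := hH he
  obtain ⟨x, y, z, hxy, hxz, hyz, rfl⟩ := Finset.card_eq_three.1 h3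
  have hone : ∀ {p q r : V}, ({p, q, r} : Finset V) = {x, y, z} → p ≠ q → p ≠ r → q ≠ r →
      p ∉ Set.range φ → q ∉ Set.range φ → False := fun h h1 h2 h3 hp hq =>
    htr (containsAsTrace_of_one_core hK hC hheavy (h ▸ he) h1 h2 h3 hp hq)
  have htwo : ∀ {p q r : V}, ({p, q, r} : Finset V) = {x, y, z} → q ≠ r →
      p ∉ Set.range φ → q ∈ Set.range φ → r ∈ Set.range φ →
      {x, y, z} ∈ cone ((⊤ : SimpleGraph (Fin (s + 2))).deleteEdges
        (C : Set (Sym2 (Fin (s + 2))))) φ := by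
    rintro p _ _ h hqr hp ⟨a, rfl⟩ ⟨b, rfl⟩
    refine mem_cone.2 (Or.inl ⟨p, hp, a, b, ?_, h.symm⟩)
    rw [SimpleGraph.deleteEdges_adj, SimpleGraph.top_adj]
    exact ⟨fun hab => hqr (hab ▸ rfl), fun hab =>
      htr (containsAsTrace_of_two_core hK hC hheavy hp (mem_coe.1 hab) (h ▸ he))⟩
  have e1 : ({y, x, z} : Finset V) = {x, y, z} := Finset.insert_comm _ _ _
  have e2 : ({z, x, y} : Finset V) = {x, y, z} := by
    rw [Finset.insert_comm, Finset.pair_comm z y]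
  have e3 : ({x, z, y} : Finset V) = {x, y, z} := by rw [Finset.pair_comm]
  have e4 : ({y, z, x} : Finset V) = {x, y, z} := by rw [Finset.pair_comm z x, e1]
  by_cases hx : x ∈ Set.range φ <;> by_cases hy : y ∈ Set.range φ <;>
    by_cases hz : z ∈ Set.range φ
  · refine mem_cone.2 (Or.inr ⟨h3, fun w hw => ?_⟩)
    simp only [mem_insert, mem_singleton] at hw
    rcases hw with rfl | rfl | rfl <;> assumption
  · exact htwo e2 hxy hz hx hy
  · exact htwo e1 hxz hy hx hz
  · exact (hone e4 hyz hxy.symm hxz.symm hy hz).elim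
  · exact htwo rfl hyz hx hy hz
  · exact (hone e3 hxz hxy hyz.symm hx hz).elim
  · exact (hone rfl hxy hxz hyz hx hy).elim
  · exact (hone rfl hxy hxz hyz hx hy).elim

theorem exists_subset_of_card_edgeFinset (hs : 1 ≤ s) (hV : s + 2 ≤ Fintype.card V)
    (hH : IsTraceFree 3 H (matching (s + 1))) (hK : 3 * (s + 1) ≤ K)
    [DecidableRel (heavyGraph H K).Adj]
    (he : s * (s + 2) / 2 ≤ #(heavyGraph H K).edgeFinset) :
    ∃ H', IsExtremalConstruction s H' ∧ H ⊆ H' := by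
  classical
  have hG : ∀ X, Escaping (heavyGraph H K) X → #X ≤ s := by
    intro X hX
    by_contra! hlt
    obtain ⟨Y, hYX, hY⟩ := Finset.exists_subset_card_eq hlt
    exact hH.2 (containsAsTrace_of_escaping hK hY (hX.mono hYX))
  obtain ⟨A, hA, hsupp, hnon⟩ := exists_support_of_card_edgeFinset hs hV hG he
  let ε : Fin (s + 2) ≃ A := (Finset.equivFinOfCardEq hA).symm
  let φ : Fin (s + 2) ↪ V := ε.toEmbedding.trans (Function.Embedding.subtype _)
  have hφ : ∀ v ∈ A, ∃ a, φ a = v := fun v hv => ⟨ε.symm ⟨v, hv⟩, by simp [φ]⟩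
  let G : SimpleGraph (Fin (s + 2)) := (heavyGraph H K).comap φ
  have hGadj : ∀ a b, G.Adj a b ↔ (heavyGraph H K).Adj (φ a) (φ b) := fun _ _ => Iff.rfl
  -- The non-heavy pairs of the core cover it, and their number is that of a minimum cover.
  let C : Finset (Sym2 (Fin (s + 2))) := Gᶜ.edgeFinset
  have hCmem : ∀ a b, s(a, b) ∈ C ↔ a ≠ b ∧ ¬ G.Adj a b := fun a b => by
    simp [C]
  have hCcov : IsEdgeCover (⊤ : SimpleGraph (Fin (s + 2))) C := by
    constructor
    · intro e he
      induction e using Sym2.ind with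
      | _ a b => simpa using ((hCmem a b).1 he).1
    · intro a
      obtain ⟨v, hvA, hva, hv⟩ := hnon (φ a) (ε a).2
      obtain ⟨b, rfl⟩ := hφ v hvA
      exact ⟨s(a, b), (hCmem a b).2 ⟨fun h => hva (h ▸ rfl), hv⟩, by simp⟩
  have hcard : #(heavyGraph H K).edgeFinset = #G.edgeFinset := by
    have hmap : (heavyGraph H K).edgeFinset = G.edgeFinset.image (Sym2.map φ) := by
      ext e
      simp only [mem_image, SimpleGraph.mem_edgeFinset]
      constructor
      · induction e using Sym2.ind with
        | _ x y =>
          intro hxy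
          obtain ⟨a, rfl⟩ := hφ x (hsupp x y hxy)
          obtain ⟨b, rfl⟩ := hφ y (hsupp y _ hxy.symm)
          exact ⟨s(a, b), hxy, rfl⟩
      · rintro ⟨e', he', rfl⟩
        induction e' using Sym2.ind with
        | _ a b => exact he'
    rw [hmap, Finset.card_image_of_injective _ (Sym2.map.injective φ.injective)]
  have hCcard : #C ≤ (s + 3) / 2 := by
    have h1 : #G.edgeFinset + #C = (s + 2).choose 2 := by
      have hdisj : Disjoint G.edgeFinset C := by
        rw [Finset.disjoint_left]
        intro e he he'
        induction e using Sym2.ind with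
        | _ a b => exact ((hCmem a b).1 he').2 (by simpa using he)
      rw [← Finset.card_union_of_disjoint hdisj]
      have : G.edgeFinset ∪ C = (⊤ : SimpleGraph (Fin (s + 2))).edgeFinset := by
        ext e
        induction e using Sym2.ind with
        | _ a b =>
          rw [mem_union, hCmem, SimpleGraph.mem_edgeFinset, SimpleGraph.mem_edgeFinset,
            SimpleGraph.mem_edgeSet, SimpleGraph.mem_edgeSet, SimpleGraph.top_adj]
          constructor
          · rintro (h | h)
            · exact h.ne
            · exact h.1
          · tauto
      rw [this, SimpleGraph.card_edgeFinset_top_eq_card_choose_two, Fintype.card_fin]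
    rw [choose_two_add_two] at h1
    omega
  have hCmin : IsMinimumEdgeCover (⊤ : SimpleGraph (Fin (s + 2))) C := by
    refine isMinimumEdgeCover_iff.2 ⟨hCcov, ?_⟩
    have := card_le_two_mul_of_isEdgeCover hCcov
    rw [Fintype.card_fin] at this
    omega
  refine ⟨_, ⟨C, hCmin, φ, rfl⟩, subset_cone hH.1 hH.2 hK hCmin fun a b hab hC => ?_⟩
  rw [hCmem] at hC
  exact (hGadj a b).1 (by tauto)

/-- The stability dichotomy. If the heavy graph has fewer than `s (s + 2) / 2` edges, then the heavy
pairs account for too few hyperedges, up to the bounded number of light ones. -/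
theorem exists_subset_or_card_lt (hs : 1 ≤ s)
    (hV : s * 3 * (s * 2 * (3 * (s + 1))) + s * (s + 2) / 2 * (s + 2) + (s + 3) ≤ Fintype.card V)
    (hH : IsTraceFree 3 H (matching (s + 1))) :
    (∃ H', IsExtremalConstruction s H' ∧ H ⊆ H') ∨
      #H < s * (s + 2) / 2 * (Fintype.card V - s - 2) + (s + 2).choose 3 := by
  classical
  rcases le_or_gt (s * (s + 2) / 2) #(heavyGraph H (3 * (s + 1))).edgeFinset with h | h
  · exact Or.inl (exists_subset_of_card_edgeFinset hs (by omega) hH le_rfl h)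
  · right
    have h1 := card_le_add_card_light (K := 3 * (s + 1)) hH.1
    have h2 := card_light_le (K := 3 * (s + 1)) hH.1 hH.2
    obtain ⟨t, ht⟩ := Nat.exists_eq_add_of_le (show s + 2 ≤ Fintype.card V by omega)
    have h3 := Nat.mul_le_mul_right (Fintype.card V) (Nat.succ_le_of_lt h)
    rw [show Fintype.card V - s - 2 = t by omega]
    rw [ht] at h1 h3 hV
    generalize s * (s + 2) / 2 = f at *
    generalize s * 3 * (s * 2 * (3 * (s + 1))) = L at *
    generalize #(heavyGraph H (3 * (s + 1))).edgeFinset = E at *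
    nlinarith

end Structure

section Extremal

variable {V : Type*} [Fintype V] {s : ℕ} {H H' : Finset (Finset V)}

theorem IsExtremalConstruction.isTraceFree [DecidableEq V] (hs : 1 ≤ s)
    (h : IsExtremalConstruction s H) : IsTraceFree 3 H (matching (s + 1)) := by
  obtain ⟨C, hC, φ, rfl⟩ := h
  refine ⟨sized_cone, not_containsAsTrace_cone hs (Fintype.card_fin _) fun a => ?_⟩
  obtain ⟨b, hba, hb⟩ := hC.1.exists_adj a
  refine ⟨b, hba, fun hab => ?_⟩
  rw [SimpleGraph.deleteEdges_adj] at hab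
  exact hab.2 hb

theorem IsExtremalConstruction.card_eq (h : IsExtremalConstruction s H) :
    #H = s * (s + 2) / 2 * (Fintype.card V - s - 2) + (s + 2).choose 3 := by
  classical
  obtain ⟨C, hC, φ, rfl⟩ := h
  rw [card_cone, card_edgeFinset_deleteEdges hC, Fintype.card_fin, Nat.sub_sub]

theorem IsExtremalConstruction.isomorphic (h : IsExtremalConstruction s H)
    (h' : IsExtremalConstruction s H') : Isomorphic H H' := by
  classical
  obtain ⟨C, hC, φ, rfl⟩ := h
  obtain ⟨C', hC', φ', rfl⟩ := h'
  obtain ⟨σ, hσ⟩ := exists_perm_of_isMinimumEdgeCover hC hC'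
  exact isomorphic_cone hσ

theorem exists_isExtremalConstruction (hV : s + 2 ≤ Fintype.card V) :
    ∃ H : Finset (Finset V), IsExtremalConstruction s H := by
  obtain ⟨C, hC, hle⟩ := exists_isEdgeCover s
  have h := card_le_two_mul_of_isEdgeCover hC
  rw [Fintype.card_fin] at h
  obtain ⟨φ⟩ := Function.Embedding.nonempty_of_card_le
    ((Fintype.card_fin (s + 2)).trans_le hV)
  exact ⟨_, C, isMinimumEdgeCover_iff.2 ⟨hC, by omega⟩, φ, rfl⟩

theorem card_le_of_isTraceFree [DecidableEq V] (hs : 1 ≤ s)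
    (hV : s * 3 * (s * 2 * (3 * (s + 1))) + s * (s + 2) / 2 * (s + 2) + (s + 3) ≤ Fintype.card V)
    (hH : IsTraceFree 3 H (matching (s + 1))) :
    #H ≤ s * (s + 2) / 2 * (Fintype.card V - s - 2) + (s + 2).choose 3 := by
  rcases exists_subset_or_card_lt hs hV hH with ⟨H', hH', hsub⟩ | h
  · exact (Finset.card_le_card hsub).trans hH'.card_eq.le
  · exact h.le

theorem isTraceFree_and_card_eq_iff [DecidableEq V] (hs : 1 ≤ s)
    (hV : s * 3 * (s * 2 * (3 * (s + 1))) + s * (s + 2) / 2 * (s + 2) + (s + 3) ≤ Fintype.card V) :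
    IsTraceFree 3 H (matching (s + 1)) ∧
        #H = s * (s + 2) / 2 * (Fintype.card V - s - 2) + (s + 2).choose 3 ↔
      IsExtremalConstruction s H := by
  constructor
  · rintro ⟨hH, hc⟩
    rcases exists_subset_or_card_lt hs hV hH with ⟨H', hH', hsub⟩ | h
    · rwa [Finset.eq_of_subset_of_card_le hsub (hH'.card_eq.trans hc.symm).le]
    · omega
  · exact fun h => ⟨h.isTraceFree hs, h.card_eq⟩

end Extremal

end TraceMatching

theorem theorem1p3 (s : ℕ) (hs : 1 ≤ s) :
    ∃ N : ℕ, s + 2 ≤ N ∧ ∀ n : ℕ, N ≤ n →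
      TraceMatching.exTrace 3 n (TraceMatching.matching (s + 1)) =
          (s * (s + 2) / 2) * (n - s - 2) + (s + 2).choose 3 ∧
      (∀ H : Finset (Finset (Fin n)),
        (TraceMatching.IsTraceFree 3 H (TraceMatching.matching (s + 1)) ∧
            H.card = TraceMatching.exTrace 3 n (TraceMatching.matching (s + 1))) ↔
          TraceMatching.IsExtremalConstruction s H) ∧
      (∀ H H' : Finset (Finset (Fin n)),
        TraceMatching.IsExtremalConstruction s H → TraceMatching.IsExtremalConstruction s H' →
          TraceMatching.Isomorphic H H') := by
  refine ⟨s * 3 * (s * 2 * (3 * (s + 1))) + s * (s + 2) / 2 * (s + 2) + (s + 3), by omega,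
    fun n hn => ?_⟩
  have hV : s * 3 * (s * 2 * (3 * (s + 1))) + s * (s + 2) / 2 * (s + 2) + (s + 3)
      ≤ Fintype.card (Fin n) := by rwa [Fintype.card_fin]
  have hex : TraceMatching.exTrace 3 n (TraceMatching.matching (s + 1)) =
      (s * (s + 2) / 2) * (n - s - 2) + (s + 2).choose 3 := by
    refine IsGreatest.csSup_eq ⟨?_, ?_⟩
    · obtain ⟨H, hH⟩ := TraceMatching.exists_isExtremalConstruction (V := Fin n) (s := s)
        (by omega)
      refine ⟨H, hH.isTraceFree hs, ?_⟩
      rw [hH.card_eq, Fintype.card_fin]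
    · rintro m ⟨H, hH, rfl⟩
      have := TraceMatching.card_le_of_isTraceFree hs hV hH
      rwa [Fintype.card_fin] at this
  refine ⟨hex, fun H => ?_, fun H H' h h' => h.isomorphic h'⟩
  rw [hex, ← TraceMatching.isTraceFree_and_card_eq_iff hs hV, Fintype.card_fin]
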